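/- Let $K$ be a field of characteristic zero and $I$ a finite set. Let $\mathcal{H}_I$ be the Connes–Kreimer Hopf algebra of rooted trees decorated by $I$: the polynomial algebra over $K$ generated by these trees, with coproduct $\Delta(t)=\sum_c P^c(t)\otimes R^c(t)$ over the admissible cuts $c$ of $t$ (the empty cut and the total cut included). Let $B_i^+$ be the operator grafting the trees of a forest on a common root decorated by $i$, and let $\widehat{\mathcal{H}_I}=\prod_n \mathcal{H}_I(n)$ be the completion for the grading by the number of vertices. For formal series $F_i\in K[[h_j,\ j\in I]]$ ($i\in I$), the system $X_i=B_i^+(F_i(X_j,\ j\in I))$, $i\in I$, has a unique solution in $\widehat{\mathcal{H}_I}$; the system is called Hopf if the subalgebra of $\mathcal{H}_I$ generated by the homogeneous components of the $X_i$, $i\in I$, is a Hopf subalgebra of $\mathcal{H}_I$. For $\beta,\lambda\in K$ put $$f_\beta(h)=\sum_{k\ge 0}\frac{(1+\beta)\cdots(1+(k-1)\beta)}{k!}h^k,\qquad f_{\beta/\lambda}(\lambda h)=\sum_{k\geq 0}\frac{\lambda(\lambda+\beta)\cdots(\lambda+(k-1)\beta)}{k!}h^k,$$ so that $f_\beta(h)=(1-\beta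 h)^{-1/\beta}$ if $\beta\ne0$ and $f_0(h)=e^h$; the second expression is read as $1$ if $\lambda=0$. The series $-\frac1\beta\ln(1-\beta h)$ is read as $h$ if $\beta=0$. **Theorem.** Let $I=I_0\sqcup J_0\sqcup K_0\sqcup I_1\sqcup J_1$ be a partition, whose parts may be empty, with $I_0\cup J_0\neq\emptyset$. Suppose that scalars as below are given, and that the series $F_i$ are the following: 1. For $i\in I_0$, with $\beta_i\in K$: $$F_i=f_{\beta_i}(h_i)\prod_{j\in I_0\setminus\{i\}}f_{\frac{\beta_j}{1+\beta_j}}((1+\beta_j)h_j)\prod_{j\in J_0}f_1(h_j).$$ 2. For $i\in J_0$: $$F_i=\prod_{j\in I_0}f_{\frac{\beta_j}{1+\beta_j}}((1+\beta_j)h_j)\prod_{j\in J_0\setminus\{i\}}f_1(h_j).$$ 3. For $i\in K_0$: $$F_i=\prod_{j\in I_0}f_{\frac{\beta_j}{1+\beta_j}}((1+\beta_j)h_j)\prod_{j\in J_0}f_1(h_j).$$ 4. For $i\in I_1$, with $\nu_i\in K$ and scalars $(a^{(i)}_j)_{j\in I_0\cup J_0\cup K_0}$ such that $\nu_i\ne1$,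 or $a^{(i)}_j\neq1+\beta_j$ for some $j\in I_0$, or $a^{(i)}_j\ne1$ for some $j\in J_0$, or $a^{(i)}_j\neq0$ for some $j\in K_0$: if $\nu_i\neq0$, $$F_i=\frac1{\nu_i}\prod_{j\in I_0}f_{\frac{\beta_j}{\nu_ia^{(i)}_j}}(\nu_ia^{(i)}_jh_j)\prod_{j\in J_0}f_{\frac1{\nu_ia^{(i)}_j}}(\nu_ia^{(i)}_jh_j)\prod_{j\in K_0}f_0(\nu_ia^{(i)}_jh_j)+1-\frac1{\nu_i},$$ and if $\nu_i=0$, $$F_i=-\sum_{j\in I_0}\frac{a^{(i)}_j}{\beta_j}\ln(1-\beta_jh_j)-\sum_{j\in J_0}a^{(i)}_j\ln(1-h_j)+\sum_{j\in K_0}a^{(i)}_jh_j+1.$$ 5. For $i\in J_1$, with $\nu_i\in K\setminus\{0\}$ and scalars $a^{(i)}_j$ ($j\in I_1$) such that $I_1^{(i)}=\{j\in I_1: a^{(i)}_j\ne0\}$ is not empty, $\nu_j=1$ for all $j\in I_1^{(i)}$, and $F_j=F_k$ for all $j,k\in I_1^{(i)}$; then, for $t\in I_0\cup J_0\cup K_0$,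 the scalar $b^{(i)}_t=a^{(j)}_t$ does not depend on the choice of $j\in I_1^{(i)}$, and $$F_i=\frac1{\nu_i}\prod_{j\in I_0}f_{\frac{\beta_j}{b^{(i)}_j-1-\beta_j}}\big((b^{(i)}_j-1-\beta_j)h_j\big)\prod_{j\in J_0}f_{\frac1{b^{(i)}_j-1}}\big((b^{(i)}_j-1)h_j\big)\prod_{j\in K_0}f_0(b^{(i)}_jh_j)+\sum_{j\in I_1^{(i)}}a^{(i)}_jh_j+1-\frac1{\nu_i}.$$ Then the system $X_i=B_i^+(F_i(X_j,\ j\in I))$, $i\in I$, is Hopf. -/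

import Mathlib

open scoped TensorProduct

noncomputable section

namespace DysonSchwinger

/-! ### Decorated rooted trees -/

/-- Plane rooted trees with vertices decorated by `D`: a decorated root and the list of the
subtrees attached to it. -/
inductive PlaneTree (D : Type*) where
  | node : D → List (PlaneTree D) → PlaneTree D

namespace PlaneTree

variable {D : Type*}

/-- Two plane trees related by the exchange of two neighbouring subtrees at some vertex. -/
inductive Swap : PlaneTree D → PlaneTree D → Prop
  | swap (d : D) (l : List (PlaneTree D)) (s t : PlaneTree D) (r : List (PlaneTree D)) :
      Swap (node d (l ++ s :: t :: r)) (node d (l ++ t :: s :: r))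
  | inside (d : D) (l : List (PlaneTree D)) {s t : PlaneTree D} (r : List (PlaneTree D)) :
      Swap s t → Swap (node d (l ++ s :: r)) (node d (l ++ t :: r))

mutual
/-- The weight of a tree is the number of its vertices. -/
def weight : PlaneTree D → ℕ
  | node _ ts => weightList ts + 1
/-- The number of vertices of a plane forest. -/
def weightList : List (PlaneTree D) → ℕ
  | [] => 0
  | t :: ts => weight t + weightList ts
end

mutual
/-- The non-total admissible cuts of a tree, the empty one included, each given as the pair
`(P, R)`: `R` is the component of the root, and `P` is the list of the other components.
An admissible cut of `node d ts` is the choice, for every `t` in `ts`, either of the edge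
from the root to `t` (and then of no edge of `t`), or of an admissible cut of `t`. -/
def admCuts : PlaneTree D → List (List (PlaneTree D) × PlaneTree D)
  | node d ts => (childAdmCuts ts).map fun c => (c.1, node d c.2)
/-- The same for all the subtrees attached to a vertex: `(P, R)` with `R` the list of the
components which remain attached to that vertex. -/
def childAdmCuts : List (PlaneTree D) → List (List (PlaneTree D) × List (PlaneTree D))
  | [] => [([], [])]
  | t :: ts =>
      ((childAdmCuts ts).map fun c => (t :: c.1, c.2)) ++
        (admCuts t).flatMap fun p => (childAdmCuts ts).map fun c => (p.1 ++ c.1, p.2 :: c.2)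
end

mutual
/-- All the non-total cuts (that is, sets of edges) of a tree, each given as `(n, W, R)`: `n` is
the number of edges of the cut, `R` is the component of the root, and `W` is the list of the
other components. -/
def allCuts : PlaneTree D → List (ℕ × List (PlaneTree D) × PlaneTree D)
  | node d ts => (childAllCuts ts).map fun c => (c.1, c.2.1, node d c.2.2)
/-- The same for all the subtrees attached to a vertex; the edge from this vertex to a subtree
is cut in the first half of the list, and kept in the second half. -/
def childAllCuts : List (PlaneTree D) → List (ℕ × List (PlaneTree D) × List (PlaneTree D))
  | [] => [(0, [], [])]
  | t :: ts =>
      ((allCuts t).flatMap fun p => (childAllCuts ts).map fun c =>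
          (p.1 + c.1 + 1, p.2.2 :: (p.2.1 ++ c.2.1), c.2.2)) ++
        (allCuts t).flatMap fun p => (childAllCuts ts).map fun c =>
          (p.1 + c.1, p.2.1 ++ c.2.1, p.2.2 :: c.2.2)
end

theorem weightList_append (l r : List (PlaneTree D)) :
    weightList (l ++ r) = weightList l + weightList r := by
  induction l with
  | nil => simp [weightList]
  | cons t l ih => simp [weightList, ih, add_assoc]

theorem Swap.weight_eq {s t : PlaneTree D} (h : Swap s t) : weight s = weight t := by
  induction h with
  | swap d l s t r => simp only [weight, weightList, weightList_append]; omega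
  | inside d l r _ ih => simp only [weight, weightList, weightList_append, ih]

end PlaneTree

open PlaneTree

/-- Rooted trees decorated by `D`: plane trees up to the order of the subtrees at each vertex. -/
def Tree (D : Type*) : Type _ := Quot (PlaneTree.Swap (D := D))

namespace Tree

variable {D : Type*}

/-- The rooted tree underlying a plane tree. -/
def mk (t : PlaneTree D) : Tree D := Quot.mk _ t

/-- The number of vertices of a tree. -/
def weight (t : Tree D) : ℕ := Quot.lift PlaneTree.weight (fun _ _ h => h.weight_eq) t

/-- A plane tree underlying a tree. -/
def out (t : Tree D) : PlaneTree D := Quot.out t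

theorem mk_out (t : Tree D) : mk t.out = t := Quot.out_eq t

theorem mk_node_perm (d : D) {l r : List (PlaneTree D)} (h : l.Perm r) :
    mk (node d l) = mk (node d r) := by
  have key : ∀ p : List (PlaneTree D), mk (node d (p ++ l)) = mk (node d (p ++ r)) := by
    induction h with
    | nil => intro p; rfl
    | cons x _ ih => intro p; simpa using ih (p ++ [x])
    | swap x y l => intro p; exact Quot.sound (Swap.swap d p y x l)
    | trans _ _ ih₁ ih₂ => intro p; exact (ih₁ p).trans (ih₂ p)
  simpa using key []

theorem mk_node_congr (d : D) (p : List (PlaneTree D)) {s t : PlaneTree D} (h : mk s = mk t)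
    (r : List (PlaneTree D)) : mk (node d (p ++ s :: r)) = mk (node d (p ++ t :: r)) := by
  have h' := Quot.eqvGen_exact h
  induction h' with
  | rel x y hxy => exact Quot.sound (Swap.inside d p r hxy)
  | refl x => rfl
  | symm x y _ ih => exact (ih (Quot.eqvGen_sound ‹_›)).symm
  | trans x y z _ _ ih₁ ih₂ =>
    exact (ih₁ (Quot.eqvGen_sound ‹_›)).trans (ih₂ (Quot.eqvGen_sound ‹_›))

/-- The tree obtained by grafting the trees of a forest on a common root decorated by `d`. -/
def graft (d : D) (s : Multiset (Tree D)) : Tree D :=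
  Quotient.liftOn s (fun l => mk (node d (l.map out))) fun _ _ h => mk_node_perm d (h.map out)

theorem graft_mk (d : D) (ts : List (PlaneTree D)) :
    graft d (ts.map mk : List (Tree D)) = mk (node d ts) := by
  have key : ∀ p : List (PlaneTree D),
      mk (node d (p ++ (ts.map mk).map out)) = mk (node d (p ++ ts)) := by
    induction ts with
    | nil => intro p; rfl
    | cons t ts ih =>
      intro p
      have h₁ := mk_node_congr d p (mk_out (mk t)) ((ts.map mk).map out)
      have h₂ := ih (p ++ [t])
      simp only [List.append_assoc, List.cons_append, List.nil_append] at h₂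
      simpa using h₁.trans h₂
  exact key []

theorem weight_mk (t : PlaneTree D) : weight (mk t) = t.weight := rfl

theorem weightList_eq_sum (l : List (PlaneTree D)) :
    weightList l = (l.map PlaneTree.weight).sum := by
  induction l with
  | nil => simp [weightList]
  | cons t l ih => simp [weightList, ih]

theorem weight_graft (d : D) (s : Multiset (Tree D)) :
    weight (graft d s) = (s.map weight).sum + 1 := by
  induction s using Quotient.inductionOn with
  | _ l =>
    have h : graft d (l : Multiset (Tree D)) = mk (node d (l.map out)) := rfl
    have h' : PlaneTree.weight ∘ out = (weight : Tree D → ℕ) := by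
      funext t
      conv_rhs => rw [← mk_out t]
      rfl
    simp [h, weight_mk, PlaneTree.weight, weightList_eq_sum, h']

end Tree

/-! ### The Hopf algebra of decorated rooted trees -/

/-- The polynomial algebra generated by the rooted trees decorated by `D`; its monomials are
the rooted forests. -/
abbrev TreeAlg (K : Type*) [Field K] (D : Type*) := MvPolynomial (Tree D) K

section Hopf

variable (K : Type*) [Field K] {D : Type*}

/-- The generator of the algebra given by a plane tree. -/
def treeVar (t : PlaneTree D) : TreeAlg K D := MvPolynomial.X (Tree.mk t)

/-- The monomial given by a list of plane trees. -/
def forest (l : List (PlaneTree D)) : TreeAlg K D := (l.map (treeVar K)).prod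

/-- The linear grafting operator: it sends the forest `t₁ ⋯ tₙ` to the tree obtained by grafting
`t₁, …, tₙ` on a common root decorated by `d`. -/
def Bplus (d : D) : TreeAlg K D →ₗ[K] TreeAlg K D :=
  (MvPolynomial.basisMonomials (Tree D) K).constr K fun s =>
    (MvPolynomial.X (Tree.graft d (Finsupp.toMultiset s)) : TreeAlg K D)

theorem Bplus_monomial (d : D) (s : Tree D →₀ ℕ) :
    Bplus K d (MvPolynomial.monomial s 1) =
      MvPolynomial.X (Tree.graft d (Finsupp.toMultiset s)) := by
  have h : MvPolynomial.monomial s (1 : K) = MvPolynomial.basisMonomials (Tree D) K s := by simp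
  rw [Bplus, h, Module.Basis.constr_basis]

theorem forest_eq_monomial [DecidableEq (Tree D)] (l : List (PlaneTree D)) :
    forest K l =
      MvPolynomial.monomial (Multiset.toFinsupp ((l.map Tree.mk : List (Tree D)) :
        Multiset (Tree D))) 1 := by
  induction l with
  | nil => simp [forest]
  | cons t l ih =>
    have : forest K (t :: l) = treeVar K t * forest K l := by simp [forest]
    rw [this, ih, treeVar, MvPolynomial.X, MvPolynomial.monomial_mul, List.map_cons,
      ← Multiset.cons_coe, ← Multiset.singleton_add, map_add, Multiset.toFinsupp_singleton, one_mul]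

theorem Bplus_forest (d : D) (l : List (PlaneTree D)) :
    Bplus K d (forest K l) = treeVar K (node d l) := by
  classical
  rw [forest_eq_monomial, Bplus_monomial, Multiset.toFinsupp_toMultiset, Tree.graft_mk, treeVar]

/-- `∑ P ⊗ R` over the non-total admissible cuts of a plane tree. -/
def admSum (t : PlaneTree D) : TreeAlg K D ⊗[K] TreeAlg K D :=
  ((admCuts t).map fun c => forest K c.1 ⊗ₜ[K] treeVar K c.2).sum

/-- The coproduct of a plane tree: `∑ P ⊗ R` over its admissible cuts, the total cut (with
`P = t` and `R = 1`) included. -/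
def coprodPlane (t : PlaneTree D) : TreeAlg K D ⊗[K] TreeAlg K D :=
  treeVar K t ⊗ₜ[K] 1 + admSum K t

/-- `∑ (-1) ^ n • (W ⊗ R)` over the non-total cuts of a plane tree. -/
def cutSum (t : PlaneTree D) : TreeAlg K D ⊗[K] TreeAlg K D :=
  ((allCuts t).map fun c => (-1 : K) ^ c.1 • (forest K c.2.1 ⊗ₜ[K] treeVar K c.2.2)).sum

/-- The antipode of a plane tree: `- ∑ (-1) ^ n W R` over its non-total cuts, where `n` is the
number of edges of the cut, and `W R` is the product of all the trees left by the cut. -/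
def antipodePlane (t : PlaneTree D) : TreeAlg K D :=
  -((allCuts t).map fun c => (-1 : K) ^ c.1 • (forest K c.2.1 * treeVar K c.2.2)).sum

theorem forest_cons (t : PlaneTree D) (l : List (PlaneTree D)) :
    forest K (t :: l) = treeVar K t * forest K l := by simp [forest]

theorem forest_append (l r : List (PlaneTree D)) :
    forest K (l ++ r) = forest K l * forest K r := by simp [forest]

theorem list_sum_mul_sum {A B R : Type*} [CommSemiring R] (l : List A) (m : List B)
    (f : A → R) (g : B → R) :
    (l.flatMap fun a => m.map fun b => f a * g b).sum = (l.map f).sum * (m.map g).sum := by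
  induction l with
  | nil => simp
  | cons a l ih => simp [ih, add_mul, List.sum_map_mul_left]

theorem childAdm_sum (ts : List (PlaneTree D)) :
    ((childAdmCuts ts).map fun c => forest K c.1 ⊗ₜ[K] forest K c.2).sum =
      (ts.map (coprodPlane K)).prod := by
  induction ts with
  | nil => simp [childAdmCuts, forest, Algebra.TensorProduct.one_def]
  | cons t ts ih =>
    rw [List.map_cons, List.prod_cons, ← ih, coprodPlane, add_mul, admSum, ← list_sum_mul_sum,
      ← List.sum_map_mul_left, childAdmCuts]
    simp [List.map_flatMap, Function.comp_def, forest_cons, forest_append]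

theorem admSum_node (d : D) (ts : List (PlaneTree D)) :
    admSum K (node d ts) =
      LinearMap.lTensor (TreeAlg K D) (Bplus K d) (ts.map (coprodPlane K)).prod := by
  rw [← childAdm_sum, map_list_sum, admSum, admCuts]
  simp [Function.comp_def, Bplus_forest]

theorem antipodePlane_eq (t : PlaneTree D) :
    antipodePlane K t = -LinearMap.mul' K (TreeAlg K D) (cutSum K t) := by
  rw [cutSum, map_list_sum, antipodePlane]
  simp [Function.comp_def]

theorem childAll_sum (ts : List (PlaneTree D)) :
    ((childAllCuts ts).map fun c =>
        (-1 : K) ^ c.1 • (forest K c.2.1 ⊗ₜ[K] forest K c.2.2)).sum =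
      (ts.map fun t => antipodePlane K t ⊗ₜ[K] 1 + cutSum K t).prod := by
  induction ts with
  | nil => simp [childAllCuts, forest, Algebra.TensorProduct.one_def]
  | cons t ts ih =>
    have h : antipodePlane K t ⊗ₜ[K] (1 : TreeAlg K D) =
        ((allCuts t).map fun c =>
          (-1 : K) ^ (c.1 + 1) • ((forest K c.2.1 * treeVar K c.2.2) ⊗ₜ[K] (1 : TreeAlg K D))).sum
        := by
      rw [antipodePlane, TensorProduct.neg_tmul, ← TensorProduct.mk_apply, ← LinearMap.flip_apply,
        map_list_sum, List.map_map, List.sum_neg, List.map_map]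
      congr 1
      refine List.map_congr_left fun c _ => ?_
      simp [pow_succ, TensorProduct.smul_tmul', TensorProduct.neg_tmul]
    rw [List.map_cons, List.prod_cons, ← ih, h, cutSum, add_mul, ← list_sum_mul_sum,
      ← list_sum_mul_sum, childAllCuts, List.map_append, List.sum_append, List.map_flatMap,
      List.map_flatMap]
    congr 1
    · congr 2
      funext p
      simp only [List.map_map]
      refine List.map_congr_left fun c _ => ?_
      simp only [Function.comp_apply, forest_cons, forest_append, smul_mul_smul_comm,
        Algebra.TensorProduct.tmul_mul_tmul, one_mul, ← pow_add]
      congr 2 <;> ring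
    · congr 2
      funext p
      simp only [List.map_map]
      refine List.map_congr_left fun c _ => ?_
      simp only [Function.comp_apply, forest_cons, forest_append, smul_mul_smul_comm,
        Algebra.TensorProduct.tmul_mul_tmul, ← pow_add]

theorem cutSum_node (d : D) (ts : List (PlaneTree D)) :
    cutSum K (node d ts) =
      LinearMap.lTensor (TreeAlg K D) (Bplus K d)
        (ts.map fun t => antipodePlane K t ⊗ₜ[K] 1 + cutSum K t).prod := by
  rw [← childAll_sum, map_list_sum, cutSum, allCuts]
  simp [Function.comp_def, Bplus_forest]

theorem coprodPlane_swap {s t : PlaneTree D} (h : Swap s t) :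
    coprodPlane K s = coprodPlane K t := by
  have hv : treeVar K s = treeVar K t := congrArg MvPolynomial.X (Quot.sound h)
  suffices admSum K s = admSum K t by rw [coprodPlane, coprodPlane, hv, this]
  clear hv
  induction h with
  | swap d l s t r =>
    rw [admSum_node, admSum_node]
    simp only [List.map_append, List.map_cons, List.prod_append, List.prod_cons]
    rw [mul_left_comm (coprodPlane K s)]
  | @inside d l s t r h ih =>
    have hv : treeVar K s = treeVar K t := congrArg MvPolynomial.X (Quot.sound h)
    have : coprodPlane K s = coprodPlane K t := by rw [coprodPlane, coprodPlane, hv, ih]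
    rw [admSum_node, admSum_node]
    simp only [List.map_append, List.map_cons, this]

theorem cutSum_swap {s t : PlaneTree D} (h : Swap s t) : cutSum K s = cutSum K t := by
  induction h with
  | swap d l s t r =>
    rw [cutSum_node, cutSum_node]
    simp only [List.map_append, List.map_cons, List.prod_append, List.prod_cons]
    rw [mul_left_comm (antipodePlane K s ⊗ₜ[K] 1 + cutSum K s)]
  | inside d l r h ih =>
    rw [cutSum_node, cutSum_node]
    simp only [List.map_append, List.map_cons, antipodePlane_eq, ih]

variable (D) in
/-- The coproduct: the algebra morphism with `Δ t = ∑ P ⊗ R`, over the admissible cuts of `t`. -/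
def comul : TreeAlg K D →ₐ[K] TreeAlg K D ⊗[K] TreeAlg K D :=
  MvPolynomial.aeval fun t : Tree D =>
    Quot.lift (coprodPlane K) (fun _ _ h => coprodPlane_swap K h) t

variable (D) in
/-- The antipode: the algebra morphism with `S t = - ∑ (-1) ^ n W`, over the cuts of `t`. -/
def antipode : TreeAlg K D →ₐ[K] TreeAlg K D :=
  MvPolynomial.aeval fun t : Tree D =>
    Quot.lift (antipodePlane K)
      (fun _ _ h => by rw [antipodePlane_eq, antipodePlane_eq, cutSum_swap K h]) t

variable {K} in
/-- A subalgebra `A` is a Hopf subalgebra if `Δ A ⊆ A ⊗ A` and `S A ⊆ A`. -/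
def IsHopfSubalgebra (A : Subalgebra K (TreeAlg K D)) : Prop :=
  (∀ x ∈ A, comul K D x ∈ (Algebra.TensorProduct.map A.val A.val).range) ∧
    ∀ x ∈ A, antipode K D x ∈ A

end Hopf

/-! ### Systems of Dyson-Schwinger equations -/

section Systems

variable (K : Type*) [Field K]

/-- The homogeneous component of degree `n`: it is spanned by the forests with `n` vertices. -/
def homog (D : Type*) (n : ℕ) : Submodule K (TreeAlg K D) :=
  MvPolynomial.weightedHomogeneousSubmodule K (Tree.weight (D := D)) n

/-- The completion `∏ₙ H(n)` of `H = ⨁ₙ H(n)`. An element `∑ xₙ`, with `xₙ` in `H(n)`, is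
represented by the power series `∑ xₙ zⁿ` with coefficients in `H`; the product is the
product of power series. -/
def completion (D : Type*) : Subalgebra K (PowerSeries (TreeAlg K D)) where
  carrier := {x | ∀ n, PowerSeries.coeff n x ∈ homog K D n}
  mul_mem' := by
    intro x y hx hy n
    rw [PowerSeries.coeff_mul]
    refine Submodule.sum_mem _ fun p hp => ?_
    have h := MvPolynomial.IsWeightedHomogeneous.mul (hx p.1) (hy p.2)
    rwa [Finset.HasAntidiagonal.mem_antidiagonal.1 hp] at h
  add_mem' := by
    intro x y hx hy n
    rw [map_add]
    exact Submodule.add_mem _ (hx n) (hy n)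
  algebraMap_mem' := by
    intro r n
    rw [PowerSeries.algebraMap_apply, PowerSeries.coeff_C]
    split_ifs with h
    · subst h
      exact MvPolynomial.isWeightedHomogeneous_C _ r
    · exact Submodule.zero_mem _

variable {K} {I : Type*}

/-- The grafting operator on the completion: it maps `∑ xₙ` to `∑ Bplus xₙ`, where `Bplus xₙ` is
homogeneous of degree `n + 1`. -/
def BplusHat (i : I) (x : PowerSeries (TreeAlg K I)) : PowerSeries (TreeAlg K I) :=
  PowerSeries.mk fun n => Nat.casesOn n 0 fun m => Bplus K i (PowerSeries.coeff m x)

/-- `X` is a solution in the completion of the system `X i = Bplus i (F i (X j, j ∈ I))`. -/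
def IsSolution (F : I → MvPowerSeries I K) (X : I → PowerSeries (TreeAlg K I)) : Prop :=
  (∀ i, X i ∈ completion K I) ∧ ∀ i, X i = BplusHat i (MvPowerSeries.subst X (F i))

/-- The map whose fixed points are the solutions of the system. -/
def step (F : I → MvPowerSeries I K) (X : I → PowerSeries (TreeAlg K I)) :
    I → PowerSeries (TreeAlg K I) :=
  fun i => BplusHat i (MvPowerSeries.subst X (F i))

/-- The solution of the system; its component of degree `n` is that of the `n`-th iterate. -/
def solution (F : I → MvPowerSeries I K) : I → PowerSeries (TreeAlg K I) :=
  fun i => PowerSeries.mk fun n => PowerSeries.coeff n ((step F)^[n] 0 i)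

@[simp] theorem coeff_zero_BplusHat (i : I) (x : PowerSeries (TreeAlg K I)) :
    PowerSeries.coeff 0 (BplusHat i x) = 0 := by simp [BplusHat]

@[simp] theorem coeff_succ_BplusHat (i : I) (x : PowerSeries (TreeAlg K I)) (n : ℕ) :
    PowerSeries.coeff (n + 1) (BplusHat i x) = Bplus K i (PowerSeries.coeff n x) := by
  simp [BplusHat]

theorem Bplus_homog (i : I) {n : ℕ} {x : TreeAlg K I} (hx : x ∈ homog K I n) :
    Bplus K i x ∈ homog K I (n + 1) := by
  have hx' : MvPolynomial.IsWeightedHomogeneous (Tree.weight (D := I)) x n := hx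
  rw [← MvPolynomial.support_sum_monomial_coeff x, map_sum]
  refine Submodule.sum_mem _ fun s hs => ?_
  have hw := hx' (MvPolynomial.mem_support_iff.1 hs)
  have : MvPolynomial.monomial s (MvPolynomial.coeff s x) =
      MvPolynomial.coeff s x • (MvPolynomial.monomial s 1 : TreeAlg K I) := by
    rw [MvPolynomial.smul_monomial, smul_eq_mul, mul_one]
  rw [this, map_smul, Bplus_monomial]
  refine Submodule.smul_mem _ _ ?_
  have h := MvPolynomial.isWeightedHomogeneous_X K (Tree.weight (D := I))
    (Tree.graft i (Finsupp.toMultiset s))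
  rw [Tree.weight_graft] at h
  have hsum : ((Finsupp.toMultiset s).map Tree.weight).sum = n := by
    rw [← hw, Finsupp.toMultiset_apply, Finsupp.weight_apply]
    have hm := map_finsuppSum (Multiset.sumAddMonoidHom.comp
      (Multiset.mapAddMonoidHom (Tree.weight (D := I)))) s fun a n => n • ({a} : Multiset (Tree I))
    simpa [map_nsmul] using hm
  rw [hsum] at h
  exact h

theorem coeff_unit_zero {R : Type*} [CommRing R] {x : PowerSeries R}
    (h : PowerSeries.coeff 0 x = 0) : MvPowerSeries.coeff (0 : Unit →₀ ℕ) x = 0 := by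
  rwa [PowerSeries.coeff, Finsupp.single_zero] at h

theorem coeff_subst_congr [Finite I] {X Y : I → PowerSeries (TreeAlg K I)}
    (hX : ∀ i, PowerSeries.coeff 0 (X i) = 0) (hY : ∀ i, PowerSeries.coeff 0 (Y i) = 0) {n : ℕ}
    (h : ∀ i, ∀ m < n, PowerSeries.coeff m (X i) = PowerSeries.coeff m (Y i))
    (f : MvPowerSeries I K) (m : ℕ) (hm : m < n) :
    PowerSeries.coeff m (MvPowerSeries.subst X f : PowerSeries (TreeAlg K I)) =
      PowerSeries.coeff m (MvPowerSeries.subst Y f : PowerSeries (TreeAlg K I)) := by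
  have hX' : MvPowerSeries.HasSubst X :=
    MvPowerSeries.hasSubst_of_constantCoeff_zero fun i => by
      rw [← MvPowerSeries.coeff_zero_eq_constantCoeff_apply]; exact coeff_unit_zero (hX i)
  have hY' : MvPowerSeries.HasSubst Y :=
    MvPowerSeries.hasSubst_of_constantCoeff_zero fun i => by
      rw [← MvPowerSeries.coeff_zero_eq_constantCoeff_apply]; exact coeff_unit_zero (hY i)
  rw [PowerSeries.coeff, MvPowerSeries.coeff_subst hX', MvPowerSeries.coeff_subst hY']
  refine finsum_congr fun d => ?_
  congr 1
  let J : Ideal (PowerSeries (TreeAlg K I)) := Ideal.span {PowerSeries.X ^ n}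
  have hq : ∀ i, Ideal.Quotient.mk J (X i) = Ideal.Quotient.mk J (Y i) := by
    intro i
    rw [Ideal.Quotient.eq, Ideal.mem_span_singleton, PowerSeries.X_pow_dvd_iff]
    intro k hk
    rw [map_sub, h i k hk, sub_self]
  have hp : Ideal.Quotient.mk J (d.prod fun s e => X s ^ e) =
      Ideal.Quotient.mk J (d.prod fun s e => Y s ^ e) := by
    simp only [Finsupp.prod, map_prod, map_pow, hq]
  rw [Ideal.Quotient.eq, Ideal.mem_span_singleton, PowerSeries.X_pow_dvd_iff] at hp
  have := hp m hm
  rw [map_sub, sub_eq_zero] at this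
  exact this

theorem subst_mem_completion [Finite I] {X : I → PowerSeries (TreeAlg K I)}
    (hX : ∀ i, X i ∈ completion K I) (h0 : ∀ i, PowerSeries.coeff 0 (X i) = 0)
    (f : MvPowerSeries I K) :
    (MvPowerSeries.subst X f : PowerSeries (TreeAlg K I)) ∈ completion K I := by
  intro n
  have hX' : MvPowerSeries.HasSubst X :=
    MvPowerSeries.hasSubst_of_constantCoeff_zero fun i => by
      rw [← MvPowerSeries.coeff_zero_eq_constantCoeff_apply]; exact coeff_unit_zero (h0 i)
  rw [PowerSeries.coeff, MvPowerSeries.coeff_subst hX']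
  refine finsum_induction (· ∈ homog K I n) (Submodule.zero_mem _)
    (fun _ _ hx hy => Submodule.add_mem _ hx hy) fun d => Submodule.smul_mem _ _ ?_
  exact (Subalgebra.prod_mem _ fun i _ => Subalgebra.pow_mem _ (hX i) _ :
    (d.prod fun s e => X s ^ e) ∈ completion K I) n

theorem BplusHat_mem_completion (i : I) {x : PowerSeries (TreeAlg K I)}
    (hx : x ∈ completion K I) : BplusHat i x ∈ completion K I := by
  intro n
  cases n with
  | zero => rw [coeff_zero_BplusHat]; exact Submodule.zero_mem _
  | succ n => rw [coeff_succ_BplusHat]; exact Bplus_homog i (hx n)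

theorem coeff_zero_iterate (F : I → MvPowerSeries I K) (n : ℕ) (i : I) :
    PowerSeries.coeff 0 ((step F)^[n] 0 i) = 0 := by
  cases n with
  | zero => simp
  | succ n => rw [Function.iterate_succ_apply']; exact coeff_zero_BplusHat _ _

theorem iterate_mem_completion [Finite I] (F : I → MvPowerSeries I K) (n : ℕ) (i : I) :
    (step F)^[n] 0 i ∈ completion K I := by
  induction n generalizing i with
  | zero => exact Subalgebra.zero_mem _
  | succ n ih =>
    rw [Function.iterate_succ_apply']
    exact BplusHat_mem_completion i (subst_mem_completion ih (coeff_zero_iterate F n) _)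

theorem coeff_step_congr [Finite I] (F : I → MvPowerSeries I K)
    {X Y : I → PowerSeries (TreeAlg K I)}
    (hX : ∀ i, PowerSeries.coeff 0 (X i) = 0) (hY : ∀ i, PowerSeries.coeff 0 (Y i) = 0) {n : ℕ}
    (h : ∀ i, ∀ m < n, PowerSeries.coeff m (X i) = PowerSeries.coeff m (Y i)) (i : I) :
    ∀ m < n + 1, PowerSeries.coeff m (step F X i) = PowerSeries.coeff m (step F Y i) := by
  intro m hm
  cases m with
  | zero => simp [step]
  | succ m =>
    rw [step, step, coeff_succ_BplusHat, coeff_succ_BplusHat,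
      coeff_subst_congr hX hY h (F i) m (by omega)]

theorem coeff_iterate_succ [Finite I] (F : I → MvPowerSeries I K) (n : ℕ) (i : I) :
    ∀ m < n + 1, PowerSeries.coeff m ((step F)^[n + 1] 0 i) =
      PowerSeries.coeff m ((step F)^[n] 0 i) := by
  induction n generalizing i with
  | zero =>
    intro m hm
    obtain rfl : m = 0 := by omega
    rw [coeff_zero_iterate, coeff_zero_iterate]
  | succ n ih =>
    have h := coeff_step_congr F (coeff_zero_iterate F (n + 1)) (coeff_zero_iterate F n) ih i
    rw [← Function.iterate_succ_apply' (step F) (n + 1) 0,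
      ← Function.iterate_succ_apply' (step F) n 0] at h
    exact h

theorem coeff_iterate [Finite I] (F : I → MvPowerSeries I K) {m n : ℕ} (h : m ≤ n) (i : I) :
    PowerSeries.coeff m ((step F)^[n] 0 i) = PowerSeries.coeff m (solution F i) := by
  induction n, h using Nat.le_induction with
  | base => simp [solution]
  | succ n hn ih => rw [coeff_iterate_succ F n i m (by omega), ih]

theorem coeff_zero_solution (F : I → MvPowerSeries I K) (i : I) :
    PowerSeries.coeff 0 (solution F i) = 0 := by simp [solution]

theorem solution_isSolution [Finite I] (F : I → MvPowerSeries I K) :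
    IsSolution F (solution F) := by
  refine ⟨fun i n => ?_, fun i => ?_⟩
  · rw [← coeff_iterate F le_rfl]
    exact iterate_mem_completion F n i n
  · ext1 n
    rw [← coeff_iterate F n.le_succ, Function.iterate_succ_apply']
    exact coeff_step_congr F (coeff_zero_iterate F n) (coeff_zero_solution F)
      (fun j m hm => coeff_iterate F hm.le j) i n (by omega)

theorem IsSolution.eq_solution [Finite I] {F : I → MvPowerSeries I K}
    {X : I → PowerSeries (TreeAlg K I)} (hX : IsSolution F X) : X = solution F := by
  have h0 : ∀ i, PowerSeries.coeff 0 (X i) = 0 := fun i => by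
    rw [hX.2 i, coeff_zero_BplusHat]
  have key : ∀ n, ∀ i, ∀ m < n, PowerSeries.coeff m (X i) = PowerSeries.coeff m (solution F i) := by
    intro n
    induction n with
    | zero => intro i m hm; omega
    | succ n ih =>
      intro i m hm
      have h₁ := coeff_step_congr F h0 (coeff_zero_solution F) ih i m hm
      rw [hX.2 i, (solution_isSolution F).2 i]
      exact h₁
  funext i
  ext1 n
  exact key (n + 1) i n (by omega)

/-- The subalgebra generated by the homogeneous components of the solution of the system. -/
def systemAlg (F : I → MvPowerSeries I K) : Subalgebra K (TreeAlg K I) :=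
  Algebra.adjoin K {x | ∃ (i : I) (n : ℕ), x = PowerSeries.coeff n (solution F i)}

/-- The system `X i = Bplus i (F i (X j, j ∈ I))`, `i ∈ I`, is Hopf. -/
def IsHopfSystem (F : I → MvPowerSeries I K) : Prop := IsHopfSubalgebra (systemAlg F)

end Systems

/-! ### The formal series of fundamental systems -/

section Series

variable {K : Type*} [Field K] {I : Type*}

/-- `f_β(h) = ∑ₖ (1 + β) ⋯ (1 + (k - 1) β) / k! hᵏ`; it is `(1 - β h) ^ (- 1 / β)` if `β ≠ 0`,
and `exp h` if `β = 0`. -/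
def fSeries (β : K) : PowerSeries K :=
  PowerSeries.mk fun k => (∏ m ∈ Finset.Ico 1 k, (1 + (m : K) * β)) / (k.factorial : K)

/-- `f_β(c h_j)`, as a series in the indeterminates `h_i`, `i ∈ I`. -/
def fAt (β c : K) (j : I) : MvPowerSeries I K :=
  (fSeries β).subst (c • MvPowerSeries.X j : MvPowerSeries I K)

/-- `f_{β/c}(c h_j) = ∑ₖ c (c + β) ⋯ (c + (k - 1) β) / k! h_jᵏ`; it is `1` if `c = 0`. -/
def fDiv (β c : K) (j : I) : MvPowerSeries I K := fAt (β / c) c j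

open Classical in
/-- `- (1 / β) ln (1 - β h_j) = ∑_{k ≥ 1} β ^ (k - 1) h_jᵏ / k`; it is `h_j` if `β = 0`. -/
def lnDiv [CharZero K] (β : K) (j : I) : MvPowerSeries I K :=
  if β = 0 then MvPowerSeries.X j
  else -(β⁻¹ • (PowerSeries.log K).subst (-(β • MvPowerSeries.X j : MvPowerSeries I K)))

end Series

end DysonSchwinger

end

open DysonSchwinger

/-!
# Fundamental systems of Dyson-Schwinger equations are Hopf

Let `X` be the solution of the system. The proof determines the coproduct of `X i` in closed form:
`Δ (X i) = X i ⊗ 1 + ∑ₙ P i n (X) ⊗ X i (n)`, where `X i (n)` is the component of degree `n`,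
`P i 1 = F i`, and `P i n = p i qⁿ` for `n ≥ 2` (`comul_solution`). The series `q` is
`∏_{I₀} (1 - β_j h_j) ^ (- (1 + β_j) / β_j) ∏_{J₀} (1 - h_j)⁻¹`, and for the indices of `I₀`, `J₀`
and `K₀` the series `p i` is `1 - β_i h_i`, `1 - h_i` and `1`, so that `F i = p i q`.

As `Bplus i` is a 1-cocycle, `Δ (X i) = X i ⊗ 1 + (Id ⊗ Bplus i) (F i (Δ (X j), j ∈ I))`. Such a
system has a unique solution (`eq_of_fixedPoint`), so it suffices that the proposed right-hand
side satisfies it. Let `x j = X j ⊗ 1`, and let `y j = ∑ₙ qⁿ ⊗ X j (n)` be the rescaling of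
`1 ⊗ X j` by `q(x)`. Up to the correction in degree 1, the right-hand side is `x j + p j (x) y j`,
and what is needed is
`F i (x + p(x) y) = p i (x) q(x) F i (y) + F i (x) - p i (x) q(x)` (`ShiftIdentity`). For all the
series of the theorem this comes from `1 - β (x + (1 - β x) y) = (1 - β x) (1 - β y)`: powers of
`1 - β h` become multiplicative (`binom_mul`) and its logarithm additive (`lnOf_add`); both
are proved by comparing derivatives. A linear term `∑ a_j h_j`, `j ∈ I₁`, is compatible because
`p j` is then the same series `p i q` for all the indices `j` which occur.

The formula for `Δ (X i)` shows that the subalgebra generated by the components is stable under the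
coproduct. Applying `a ⊗ b ↦ S(a) b` to it gives zero, by the defining property of the antipode
(`antipodeMul_comul_Bplus`), and this recursion on the degree gives the stability under `S`.
-/

open scoped TensorProduct

noncomputable section

namespace DysonSchwinger

open PlaneTree

/-! ### The grafting operators, the coproduct and the antipode -/

section Cocycle

variable (K : Type*) [Field K] {D : Type*}

theorem comul_treeVar (t : PlaneTree D) : comul K D (treeVar K t) = coprodPlane K t := by
  rw [comul, treeVar, MvPolynomial.aeval_X]; rfl

theorem antipode_treeVar (t : PlaneTree D) :
    antipode K D (treeVar K t) = antipodePlane K t := by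
  rw [antipode, treeVar, MvPolynomial.aeval_X]; rfl

theorem comul_forest (l : List (PlaneTree D)) :
    comul K D (forest K l) = (l.map (coprodPlane K)).prod := by
  rw [forest, map_list_prod, List.map_map]
  congr 1
  exact List.map_congr_left fun t _ => comul_treeVar K t

theorem span_range_forest :
    Submodule.span K (Set.range (forest K : List (PlaneTree D) → TreeAlg K D)) = ⊤ := by
  classical
  rw [eq_top_iff, ← (MvPolynomial.basisMonomials (Tree D) K).span_eq]
  refine Submodule.span_mono ?_
  rintro _ ⟨s, rfl⟩
  refine ⟨(Finsupp.toMultiset s).toList.map Tree.out, ?_⟩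
  rw [forest_eq_monomial, List.map_map, show Tree.mk ∘ Tree.out = (id : Tree D → Tree D) from
    funext Tree.mk_out, List.map_id, Multiset.coe_toList, Finsupp.toMultiset_toFinsupp,
    MvPolynomial.coe_basisMonomials]

/-- Linear maps on the algebra of trees are determined by their values on forests. -/
theorem linearMap_ext_forest {M : Type*} [AddCommMonoid M] [Module K M]
    {f g : TreeAlg K D →ₗ[K] M} (h : ∀ l, f (forest K l) = g (forest K l)) : f = g := by
  refine LinearMap.ext_on (span_range_forest K) ?_
  rintro _ ⟨l, rfl⟩
  exact h l

/-- The grafting operator is a 1-cocycle. -/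
theorem comul_Bplus (d : D) (y : TreeAlg K D) :
    comul K D (Bplus K d y) =
      Bplus K d y ⊗ₜ[K] 1 + LinearMap.lTensor (TreeAlg K D) (Bplus K d) (comul K D y) := by
  have h : (comul K D).toLinearMap ∘ₗ Bplus K d =
      (Algebra.TensorProduct.includeLeft (R := K) (S := K) (A := TreeAlg K D)
        (B := TreeAlg K D)).toLinearMap ∘ₗ Bplus K d +
      LinearMap.lTensor (TreeAlg K D) (Bplus K d) ∘ₗ (comul K D).toLinearMap := by
    refine linearMap_ext_forest K fun l => ?_
    simp only [LinearMap.comp_apply, LinearMap.add_apply, AlgHom.toLinearMap_apply,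
      Bplus_forest, comul_treeVar, comul_forest, coprodPlane, admSum_node,
      Algebra.TensorProduct.includeLeft_apply]
  exact LinearMap.congr_fun h y

/-- The morphism `a ⊗ b ↦ S(a) b`. -/
def antipodeMul : TreeAlg K D ⊗[K] TreeAlg K D →ₐ[K] TreeAlg K D :=
  Algebra.TensorProduct.lift (antipode K D) (AlgHom.id K _) fun _ _ => Commute.all _ _

@[simp] theorem antipodeMul_tmul (a b : TreeAlg K D) :
    antipodeMul K (a ⊗ₜ[K] b) = antipode K D a * b := by
  simp [antipodeMul]

/-- The signed sum over all cuts is obtained from the sum over admissible cuts by cutting further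
the trees above the admissible cut, which is what the antipode does. -/
theorem cutSum_eq_map_admSum : ∀ t : PlaneTree D,
    cutSum K t = Algebra.TensorProduct.map (antipode K D) (AlgHom.id K _) (admSum K t)
  | node d ts => by
    have ih : ∀ t ∈ ts, cutSum K t =
        Algebra.TensorProduct.map (antipode K D) (AlgHom.id K _) (admSum K t) :=
      fun t _ => cutSum_eq_map_admSum t
    have hcomm : ∀ z : TreeAlg K D ⊗[K] TreeAlg K D,
        Algebra.TensorProduct.map (antipode K D) (AlgHom.id K _)
          (LinearMap.lTensor (TreeAlg K D) (Bplus K d) z) =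
        LinearMap.lTensor (TreeAlg K D) (Bplus K d)
          (Algebra.TensorProduct.map (antipode K D) (AlgHom.id K _) z) := by
      intro z
      induction z with
      | zero => simp
      | tmul a b => simp
      | add a b ha hb => simp only [map_add, ha, hb]
    rw [admSum_node, hcomm, cutSum_node,
      map_list_prod (Algebra.TensorProduct.map (antipode K D) (AlgHom.id K _)), List.map_map]
    congr 2
    refine List.map_congr_left fun t ht => ?_
    simp [coprodPlane, ih t ht, antipode_treeVar]
termination_by t => sizeOf t
decreasing_by
  have := List.sizeOf_lt_of_mem ‹_ ∈ ts›
  simp; omega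

/-- The convolution product of the antipode and the identity vanishes on trees. -/
theorem antipodeMul_comul_Bplus (d : D) (y : TreeAlg K D) :
    antipodeMul K (comul K D (Bplus K d y)) = 0 := by
  have h : (antipodeMul K).toLinearMap ∘ₗ (comul K D).toLinearMap ∘ₗ Bplus K d = 0 := by
    refine linearMap_ext_forest K fun l => ?_
    have hz : ∀ z : TreeAlg K D ⊗[K] TreeAlg K D, antipodeMul K z =
        LinearMap.mul' K (TreeAlg K D)
          (Algebra.TensorProduct.map (antipode K D) (AlgHom.id K _) z) := by
      intro z
      induction z with
      | zero => simp
      | tmul a b => simp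
      | add a b ha hb => simp only [map_add, ha, hb]
    simp only [LinearMap.comp_apply, AlgHom.toLinearMap_apply, Bplus_forest, comul_treeVar,
      coprodPlane, map_add, LinearMap.zero_apply, antipodeMul_tmul, antipode_treeVar, mul_one]
    rw [hz, ← cutSum_eq_map_admSum, antipodePlane_eq, neg_add_cancel]
  exact LinearMap.congr_fun h y

end Cocycle

/-! ### Substitution of power series -/

section Substitution

variable {K : Type*} [Field K] {I : Type*} {R R' : Type*} [CommRing R] [Algebra K R]
  [CommRing R'] [Algebra K R']

theorem hasSubst_of_coeff_zero [Finite I] {X : I → PowerSeries R}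
    (hX : ∀ i, PowerSeries.constantCoeff (X i) = 0) : MvPowerSeries.HasSubst X :=
  MvPowerSeries.hasSubst_of_constantCoeff_zero hX

/-- A morphism applied to the coefficients of a substituted series may be applied beforehand to the
coefficients of the `X i`. -/
theorem map_mvSubst [Finite I] (φ : R →ₐ[K] R') {X : I → PowerSeries R}
    (hX : ∀ i, PowerSeries.constantCoeff (X i) = 0) (f : MvPowerSeries I K) :
    PowerSeries.map (φ : R →+* R') (MvPowerSeries.subst X f : PowerSeries R) =
      MvPowerSeries.subst (fun i => PowerSeries.map (φ : R →+* R') (X i)) f := by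
  have hs := hasSubst_of_coeff_zero hX
  have hs' : MvPowerSeries.HasSubst fun i => PowerSeries.map (φ : R →+* R') (X i) :=
    hasSubst_of_coeff_zero fun i => by
      rw [← PowerSeries.coeff_zero_eq_constantCoeff_apply, PowerSeries.coeff_map,
        PowerSeries.coeff_zero_eq_constantCoeff_apply, hX, map_zero]
  ext n
  rw [PowerSeries.coeff_map, PowerSeries.coeff, MvPowerSeries.coeff_subst hs, PowerSeries.coeff,
    MvPowerSeries.coeff_subst hs']
  have h := (φ : R →+ R').map_finsum
    (MvPowerSeries.coeff_subst_finite hs f (Finsupp.single () n))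
  refine h.trans (finsum_congr fun d => ?_)
  have h' : PowerSeries.map (φ : R →+* R') (d.prod fun s e => X s ^ e) =
      d.prod fun s e => PowerSeries.map (φ : R →+* R') (X s) ^ e := by
    simp only [Finsupp.prod, map_prod, map_pow]
  rw [← h']
  exact map_smul φ _ _

/-- A series over `K` may be substituted as a series over a larger ring. -/
theorem subst_map_algebraMap (f : PowerSeries K) {w : PowerSeries R}
    (hw : PowerSeries.constantCoeff w = 0) :
    PowerSeries.subst w (PowerSeries.map (algebraMap K R) f) = PowerSeries.subst w f := by
  have hs := PowerSeries.HasSubst.of_constantCoeff_zero' hw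
  ext n
  rw [PowerSeries.coeff_subst' hs, PowerSeries.coeff_subst' hs]
  exact finsum_congr fun d => by rw [PowerSeries.coeff_map, algebraMap_smul]

theorem constantCoeff_powerSubst (f : PowerSeries K) {w : PowerSeries R}
    (hw : PowerSeries.constantCoeff w = 0) :
    PowerSeries.constantCoeff (PowerSeries.subst w f : PowerSeries R) =
      algebraMap K R (PowerSeries.constantCoeff f) := by
  have hs := PowerSeries.HasSubst.of_constantCoeff_zero' hw
  rw [← PowerSeries.coeff_zero_eq_constantCoeff_apply, PowerSeries.coeff_subst' hs,
    finsum_eq_single _ 0]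
  · simp [Algebra.algebraMap_eq_smul_one]
  · intro d hd
    simp [hw, hd]

variable (K) in
/-- The power series whose coefficients of degree less than `n` lie in `B`. -/
def coeffBelow (B : Subalgebra K R) (n : ℕ) : Subalgebra K (PowerSeries R) where
  carrier := {x | ∀ m < n, PowerSeries.coeff m x ∈ B}
  mul_mem' := by
    intro x y hx hy m hm
    rw [PowerSeries.coeff_mul]
    refine Subalgebra.sum_mem _ fun p hp => ?_
    have := Finset.HasAntidiagonal.mem_antidiagonal.1 hp
    exact B.mul_mem (hx _ (by omega)) (hy _ (by omega))
  add_mem' := by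
    intro x y hx hy m hm
    rw [map_add]
    exact B.add_mem (hx m hm) (hy m hm)
  algebraMap_mem' := by
    intro r m _
    rw [PowerSeries.algebraMap_apply, PowerSeries.coeff_C]
    split_ifs
    · exact B.algebraMap_mem r
    · exact B.zero_mem

theorem X_mul_mem_coeffBelow {B : Subalgebra K R} {n : ℕ} {x : PowerSeries R}
    (hx : x ∈ coeffBelow K B n) : PowerSeries.X * x ∈ coeffBelow K B (n + 1) := by
  intro m hm
  cases m with
  | zero => simp
  | succ m => rw [PowerSeries.coeff_succ_X_mul]; exact hx m (by omega)

theorem mvSubst_mem_coeffBelow [Finite I] {B : Subalgebra K R} {n : ℕ} {X : I → PowerSeries R}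
    (h0 : ∀ i, PowerSeries.constantCoeff (X i) = 0) (hX : ∀ i, X i ∈ coeffBelow K B n)
    (f : MvPowerSeries I K) :
    (MvPowerSeries.subst X f : PowerSeries R) ∈ coeffBelow K B n := by
  intro m hm
  rw [PowerSeries.coeff, MvPowerSeries.coeff_subst (hasSubst_of_coeff_zero h0)]
  refine finsum_induction (· ∈ B) (Subalgebra.zero_mem _)
    (fun _ _ hx hy => Subalgebra.add_mem _ hx hy) fun d => Subalgebra.smul_mem _ ?_ _
  exact (Subalgebra.prod_mem _ fun i _ => Subalgebra.pow_mem _ (hX i) _ :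
    (d.prod fun s e => X s ^ e) ∈ coeffBelow K B n) m hm

theorem subst_mem_coeffBelow {B : Subalgebra K R} {n : ℕ} {w f : PowerSeries R}
    (h0 : PowerSeries.constantCoeff w = 0) (hw : w ∈ coeffBelow K B n)
    (hf : ∀ m, PowerSeries.coeff m f ∈ B) :
    (PowerSeries.subst w f : PowerSeries R) ∈ coeffBelow K B n := by
  intro m hm
  rw [PowerSeries.coeff_subst' (PowerSeries.HasSubst.of_constantCoeff_zero' h0)]
  refine finsum_induction (· ∈ B) (Subalgebra.zero_mem _)
    (fun _ _ hx hy => Subalgebra.add_mem _ hx hy) fun d => ?_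
  exact B.mul_mem (hf d) (Subalgebra.pow_mem _ hw d m hm)

/-- The coefficients of degree less than `n` of `f(X)` depend only on those of the `X i`. -/
theorem coeff_mvSubst_congr [Finite I] {X Y : I → PowerSeries R}
    (hX : ∀ i, PowerSeries.constantCoeff (X i) = 0)
    (hY : ∀ i, PowerSeries.constantCoeff (Y i) = 0) {n : ℕ}
    (h : ∀ i, ∀ m < n, PowerSeries.coeff m (X i) = PowerSeries.coeff m (Y i))
    (f : MvPowerSeries I K) (m : ℕ) (hm : m < n) :
    PowerSeries.coeff m (MvPowerSeries.subst X f : PowerSeries R) =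
      PowerSeries.coeff m (MvPowerSeries.subst Y f : PowerSeries R) := by
  rw [PowerSeries.coeff, MvPowerSeries.coeff_subst (hasSubst_of_coeff_zero hX),
    MvPowerSeries.coeff_subst (hasSubst_of_coeff_zero hY)]
  refine finsum_congr fun d => ?_
  congr 1
  let J : Ideal (PowerSeries R) := Ideal.span {PowerSeries.X ^ n}
  have hq : ∀ i, Ideal.Quotient.mk J (X i) = Ideal.Quotient.mk J (Y i) := by
    intro i
    rw [Ideal.Quotient.eq, Ideal.mem_span_singleton, PowerSeries.X_pow_dvd_iff]
    intro k hk
    rw [map_sub, h i k hk, sub_self]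
  have hp : Ideal.Quotient.mk J (d.prod fun s e => X s ^ e) =
      Ideal.Quotient.mk J (d.prod fun s e => Y s ^ e) := by
    simp only [Finsupp.prod, map_prod, map_pow, hq]
  rw [Ideal.Quotient.eq, Ideal.mem_span_singleton, PowerSeries.X_pow_dvd_iff] at hp
  have := hp m hm
  rw [map_sub, sub_eq_zero] at this
  exact this

end Substitution

/-! ### The series `(1 - β h) ^ (- c / β)` -/

section BinomialSeries

variable {K : Type*} [Field K] {R : Type*} [CommRing R] [Algebra K R]

open PowerSeries

/-- `(1 - β h) ^ (- c / β) = ∑ₖ c (c + β) ⋯ (c + (k - 1) β) / k! hᵏ`, read as `exp (c h)` if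
`β = 0`. -/
def binomSeries (β c : K) : PowerSeries K :=
  PowerSeries.mk fun k => (∏ m ∈ Finset.range k, (c + (m : K) * β)) / (k.factorial : K)

theorem constantCoeff_binomSeries (β c : K) : constantCoeff (binomSeries β c) = 1 := by
  simp [binomSeries, ← coeff_zero_eq_constantCoeff_apply]

theorem binomSeries_ode [CharZero K] (β c : K) :
    (1 - C β * X) * d⁄dX K (binomSeries β c) = C c * binomSeries β c := by
  ext n
  have key : ∀ n : ℕ, coeff (n + 1) (binomSeries β c) * ((n : K) + 1) =
      (c + n * β) * coeff n (binomSeries β c) := by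
    intro n
    have hn : ((n : K) + 1) ≠ 0 := by exact_mod_cast n.succ_ne_zero
    have hf : (n.factorial : K) ≠ 0 := by exact_mod_cast n.factorial_ne_zero
    simp only [binomSeries, coeff_mk, Finset.prod_range_succ, Nat.factorial_succ]
    generalize ∏ m ∈ Finset.range n, (c + (m : K) * β) = P
    push_cast
    field_simp
  rw [sub_mul, one_mul, map_sub, mul_assoc, coeff_C_mul, coeff_C_mul, coeff_derivative]
  cases n with
  | zero => simpa using key 0
  | succ n =>
    rw [coeff_succ_X_mul, coeff_derivative, key n, key (n + 1)]
    have := key n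
    push_cast
    linear_combination β * this

/-- Two series with the same constant term and satisfying the same linear differential equation
`u f' = v f` are equal. All the identities between powers of `1 - β w` below follow from this. -/
theorem eq_of_log_derivative [CharZero K] {u v f g : PowerSeries R}
    (hu : constantCoeff u = 1) (hf : u * d⁄dX R f = v * f) (hg : u * d⁄dX R g = v * g)
    (h0 : constantCoeff f = constantCoeff g) : f = g := by
  have hu' : IsUnit u := by rw [PowerSeries.isUnit_iff_constantCoeff, hu]; exact isUnit_one
  obtain ⟨u, rfl⟩ := hu'
  set h := f - g with hh
  have hd : d⁄dX R h = (↑u⁻¹ * v) * h := by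
    have : (u : PowerSeries R) * d⁄dX R h = v * h := by
      rw [hh, map_sub, mul_sub, hf, hg, mul_sub]
    rw [mul_assoc, ← this, ← mul_assoc, Units.inv_mul, one_mul]
  suffices ∀ n, ∀ m ≤ n, coeff m h = 0 by
    rw [← sub_eq_zero, ← hh]
    ext n
    simpa using this n n le_rfl
  intro n
  induction n with
  | zero =>
    intro m hm
    obtain rfl : m = 0 := by omega
    rw [coeff_zero_eq_constantCoeff_apply, hh, map_sub, h0, sub_self]
  | succ n ih =>
    intro m hm
    obtain hm | rfl := Nat.lt_or_eq_of_le hm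
    · exact ih m (by omega)
    have h1 : coeff n (d⁄dX R h) = 0 := by
      rw [hd, coeff_mul]
      refine Finset.sum_eq_zero fun p hp => ?_
      have := Finset.HasAntidiagonal.mem_antidiagonal.1 hp
      rw [ih p.2 (by omega), mul_zero]
    rw [coeff_derivative] at h1
    have hn : ((n : K) + 1) ≠ 0 := by exact_mod_cast n.succ_ne_zero
    have h2 : ((n : R) + 1) = algebraMap K R ((n : K) + 1) := by simp
    have h3 := (hn.isUnit.map (algebraMap K R))
    rw [← h2] at h3
    exact (h3.mul_left_eq_zero).1 h1

/-- Transfers a differential equation from `f` to `f(w)` by the chain rule. -/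
theorem one_sub_smul_mul_derivative_subst {f : PowerSeries K} {β : K} {w : PowerSeries R}
    (hw : constantCoeff w = 0) :
    (1 - β • w) * d⁄dX R (PowerSeries.subst w f) =
      PowerSeries.subst w ((1 - C β * X) * d⁄dX K f) * d⁄dX R w := by
  have hs := PowerSeries.HasSubst.of_constantCoeff_zero' hw
  have hD : PowerSeries.map (algebraMap K R) (d⁄dX K f) =
      d⁄dX R (PowerSeries.map (algebraMap K R) f) := by
    ext n; simp [coeff_derivative]
  have hw' : PowerSeries.subst w (1 - C β * X : PowerSeries K) = 1 - β • w := by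
    rw [← smul_eq_C_mul, ← PowerSeries.coe_substAlgHom hs, map_sub, map_one, map_smul,
      PowerSeries.substAlgHom_X hs]
  rw [PowerSeries.subst_mul hs, hw', ← subst_map_algebraMap f hw,
    PowerSeries.derivative_subst hs, ← hD, subst_map_algebraMap _ hw, mul_assoc]

theorem one_sub_smul_add_mul (β : K) (x y : PowerSeries R) :
    1 - β • (x + (1 - β • x) * y) = (1 - β • x) * (1 - β • y) := by
  simp only [Algebra.smul_def]; ring

theorem derivative_add_mul (β : K) (x y : PowerSeries R) :
    d⁄dX R (x + (1 - β • x) * y) = (1 - β • y) * d⁄dX R x + (1 - β • x) * d⁄dX R y := by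
  rw [map_add, Derivation.leibniz, map_sub, Derivation.map_one_eq_zero,
    Derivation.map_smul_of_tower]
  simp only [Algebra.smul_def, Algebra.algebraMap_self_apply]; ring

variable (β c c' : K) {w x y : PowerSeries R}

/-- `(1 - β w) ^ (- c / β)`, for a series `w` without constant term. -/
def binom (w : PowerSeries R) : PowerSeries R := PowerSeries.subst w (binomSeries β c)

theorem constantCoeff_binom (hw : constantCoeff w = 0) : constantCoeff (binom β c w) = 1 := by
  rw [binom, constantCoeff_powerSubst _ hw, constantCoeff_binomSeries, map_one]

theorem binom_ode [CharZero K] (hw : constantCoeff w = 0) :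
    (1 - β • w) * d⁄dX R (binom β c w) = (c • d⁄dX R w) * binom β c w := by
  have hs := PowerSeries.HasSubst.of_constantCoeff_zero' hw
  rw [binom, one_sub_smul_mul_derivative_subst hw, binomSeries_ode, ← smul_eq_C_mul,
    PowerSeries.subst_smul hs, smul_mul_assoc, smul_mul_assoc, mul_comm]

theorem binom_add [CharZero K] (hw : constantCoeff w = 0) :
    binom β (c + c') w = binom β c w * binom β c' w := by
  refine eq_of_log_derivative (K := K) (u := 1 - β • w) (v := (c + c') • d⁄dX R w) ?_
    (binom_ode β (c + c') hw) ?_ ?_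
  · simp [hw]
  · rw [Derivation.leibniz, smul_eq_mul, smul_eq_mul, add_smul]
    linear_combination binom β c w * binom_ode β c' hw + binom β c' w * binom_ode β c hw
  · rw [map_mul, constantCoeff_binom _ _ hw, constantCoeff_binom _ _ hw,
      constantCoeff_binom _ _ hw, one_mul]

theorem binom_neg_self [CharZero K] (hw : constantCoeff w = 0) :
    binom β (-β) w = 1 - β • w := by
  refine eq_of_log_derivative (K := K) (u := 1 - β • w) (v := (-β) • d⁄dX R w) ?_
    (binom_ode β (-β) hw) ?_ ?_
  · simp [hw]
  · rw [map_sub, Derivation.map_one_eq_zero, Derivation.map_smul_of_tower, neg_smul]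
    ring
  · simp [hw, constantCoeff_binom _ _ hw]

theorem binom_zero [CharZero K] (hw : constantCoeff w = 0) : binom β 0 w = 1 := by
  refine eq_of_log_derivative (K := K) (u := 1 - β • w) (v := (0 : K) • d⁄dX R w) ?_
    (binom_ode β 0 hw) ?_ ?_
  · simp [hw]
  · rw [Derivation.map_one_eq_zero]; simp
  · simp [constantCoeff_binom _ _ hw]

/-- The powers of `1 - β h` are multiplicative, as `1 - β (x + (1 - β x) y) = (1 - β x) (1 - β y)`. -/
theorem binom_mul [CharZero K] (hx : constantCoeff x = 0) (hy : constantCoeff y = 0) :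
    binom β c (x + (1 - β • x) * y) = binom β c x * binom β c y := by
  have hw : constantCoeff (x + (1 - β • x) * y) = 0 := by simp [hx, hy]
  have h1 := binom_ode β c hw
  have h2 := binom_ode β c hx
  have h3 := binom_ode β c hy
  rw [one_sub_smul_add_mul, derivative_add_mul] at h1
  refine eq_of_log_derivative (K := K) ?_ h1 ?_ ?_
  · simp [hx, hy]
  · rw [Derivation.leibniz]
    simp only [Algebra.smul_def, Algebra.algebraMap_self_apply] at h2 h3 ⊢
    linear_combination (1 - algebraMap K (PowerSeries R) β * y) * binom β c y * h2 +
      (1 - algebraMap K (PowerSeries R) β * x) * binom β c x * h3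
  · simp [constantCoeff_binom _ _ hw, constantCoeff_binom _ _ hx, constantCoeff_binom _ _ hy]

end BinomialSeries

/-! ### The series `- (1 / β) ln (1 - β h)` -/

section LogSeries

variable {K : Type*} [Field K] {R : Type*} [CommRing R] [Algebra K R]

open PowerSeries

/-- `- (1 / β) ln (1 - β h) = ∑_{k ≥ 1} β ^ (k - 1) hᵏ / k`, read as `h` if `β = 0`. -/
def lnSeries (β : K) : PowerSeries K :=
  PowerSeries.mk fun k => if k = 0 then 0 else β ^ (k - 1) / (k : K)

theorem lnSeries_ode [CharZero K] (β : K) : (1 - C β * X) * d⁄dX K (lnSeries β) = 1 := by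
  have key : ∀ n, coeff n (d⁄dX K (lnSeries β)) = β ^ n := by
    intro n
    have hn : ((n : K) + 1) ≠ 0 := by exact_mod_cast n.succ_ne_zero
    rw [coeff_derivative, lnSeries, coeff_mk, if_neg n.succ_ne_zero]
    push_cast
    rw [div_mul_cancel₀ _ hn]
  ext n
  rw [sub_mul, one_mul, map_sub, mul_assoc, coeff_C_mul, key]
  cases n with
  | zero => simp
  | succ n => rw [coeff_succ_X_mul, key, coeff_one, if_neg n.succ_ne_zero, pow_succ]; ring

variable (β : K) {w x y : PowerSeries R}

/-- `- (1 / β) ln (1 - β w)`, for a series `w` without constant term. -/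
def lnOf (w : PowerSeries R) : PowerSeries R := PowerSeries.subst w (lnSeries β)

theorem constantCoeff_lnOf (hw : constantCoeff w = 0) : constantCoeff (lnOf β w) = 0 := by
  rw [lnOf, constantCoeff_powerSubst _ hw]
  simp [lnSeries, ← coeff_zero_eq_constantCoeff_apply]

theorem lnOf_ode [CharZero K] (hw : constantCoeff w = 0) :
    (1 - β • w) * d⁄dX R (lnOf β w) = d⁄dX R w := by
  have hs := PowerSeries.HasSubst.of_constantCoeff_zero' hw
  rw [lnOf, one_sub_smul_mul_derivative_subst hw, lnSeries_ode,
    ← PowerSeries.coe_substAlgHom hs, map_one, one_mul]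

theorem lnOf_add [CharZero K] (hx : constantCoeff x = 0) (hy : constantCoeff y = 0) :
    lnOf β (x + (1 - β • x) * y) = lnOf β x + lnOf β y := by
  have hw : constantCoeff (x + (1 - β • x) * y) = 0 := by simp [hx, hy]
  have h1 := lnOf_ode β hw
  have h2 := lnOf_ode β hx
  have h3 := lnOf_ode β hy
  rw [one_sub_smul_add_mul, derivative_add_mul] at h1
  rw [← sub_eq_zero]
  refine eq_of_log_derivative (K := K) (u := (1 - β • x) * (1 - β • y)) (v := 0) ?_ ?_ ?_ ?_
  · simp [hx, hy]
  · rw [map_sub, map_add]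
    linear_combination h1 - (1 - β • y) * h2 - (1 - β • x) * h3
  · simp
  · simp [constantCoeff_lnOf _ hw, constantCoeff_lnOf _ hx, constantCoeff_lnOf _ hy]

end LogSeries

/-! ### The series of one indeterminate among several -/

section Coordinates

variable {K : Type*} [Field K] {I : Type*} {R : Type*} [CommRing R] [Algebra K R]

theorem mvSubst_powerSubst_X [Finite I] {X : I → PowerSeries R}
    (hX : ∀ i, PowerSeries.constantCoeff (X i) = 0) (f : PowerSeries K) (j : I) :
    (MvPowerSeries.subst X (PowerSeries.subst (MvPowerSeries.X j : MvPowerSeries I K) f) :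
      PowerSeries R) = PowerSeries.subst (X j) f := by
  have hs := hasSubst_of_coeff_zero hX
  rw [PowerSeries.subst, MvPowerSeries.subst_comp_subst_apply (PowerSeries.HasSubst.X j).const hs,
    PowerSeries.subst]
  congr 1
  funext _
  exact MvPowerSeries.subst_X hs j

theorem subst_smul_X (f : PowerSeries K) (c : K) (j : I) :
    PowerSeries.subst (c • MvPowerSeries.X j : MvPowerSeries I K) f =
      PowerSeries.subst (MvPowerSeries.X j : MvPowerSeries I K) (PowerSeries.rescale c f) := by
  have hX : PowerSeries.HasSubst (MvPowerSeries.X j : MvPowerSeries I K) :=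
    PowerSeries.HasSubst.X j
  rw [PowerSeries.rescale_eq_subst,
    PowerSeries.subst_comp_subst_apply (PowerSeries.HasSubst.smul_X' c) hX,
    PowerSeries.subst_smul hX, PowerSeries.subst_X hX]

/-- `(1 - β h_j) ^ (- c / β)`, as a series in the indeterminates `h_i`, `i ∈ I`. -/
def binomAt (β c : K) (j : I) : MvPowerSeries I K :=
  (binomSeries β c).subst (MvPowerSeries.X j : MvPowerSeries I K)

theorem subst_binomAt [Finite I] {X : I → PowerSeries R}
    (hX : ∀ i, PowerSeries.constantCoeff (X i) = 0) (β c : K) (j : I) :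
    (MvPowerSeries.subst X (binomAt β c j) : PowerSeries R) = binom β c (X j) :=
  mvSubst_powerSubst_X hX _ j

theorem fAt_eq_binomAt (β c : K) (j : I) : fAt β c j = binomAt (β * c) c j := by
  rw [fAt, subst_smul_X, binomAt]
  congr 1
  ext k
  rw [PowerSeries.coeff_rescale, fSeries, binomSeries, PowerSeries.coeff_mk, PowerSeries.coeff_mk,
    ← mul_div_assoc]
  congr 1
  cases k with
  | zero => simp
  | succ k =>
    rw [Finset.prod_range_succ', Finset.prod_Ico_eq_prod_range, pow_succ, Nat.cast_zero, zero_mul,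
      add_zero, mul_right_comm]
    congr 1
    rw [Nat.add_sub_cancel, ← Finset.card_range k, ← Finset.prod_const, Finset.card_range,
      ← Finset.prod_mul_distrib]
    refine Finset.prod_congr rfl fun m _ => ?_
    push_cast
    ring

theorem fDiv_eq_binomAt (β c : K) (j : I) : fDiv β c j = binomAt β c j := by
  rw [fDiv, fAt_eq_binomAt]
  -- For `c = 0` the division gives `β / 0 = 0`, but the series is `1` whatever `β` is.
  by_cases hc : c = 0
  · subst hc
    rw [mul_zero, binomAt, binomAt]
    congr 1
    ext k
    rw [binomSeries, binomSeries, PowerSeries.coeff_mk, PowerSeries.coeff_mk]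
    cases k with
    | zero => simp
    | succ k => simp [Finset.prod_range_succ']
  · rw [div_mul_cancel₀ _ hc]

theorem subst_lnDiv [CharZero K] [Finite I] {X : I → PowerSeries R}
    (hX : ∀ i, PowerSeries.constantCoeff (X i) = 0) (β : K) (j : I) :
    (MvPowerSeries.subst X (lnDiv β j) : PowerSeries R) = lnOf β (X j) := by
  rw [lnOf, ← mvSubst_powerSubst_X hX]
  congr 1
  have hs : PowerSeries.HasSubst (MvPowerSeries.X j : MvPowerSeries I K) :=
    PowerSeries.HasSubst.X j
  by_cases hβ : β = 0
  · subst hβ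
    rw [lnDiv, if_pos rfl]
    have : lnSeries (0 : K) = PowerSeries.X := by
      ext k
      rw [lnSeries, PowerSeries.coeff_mk, PowerSeries.coeff_X]
      rcases k with _ | _ | k <;> simp
    rw [this, PowerSeries.subst_X hs]
  · rw [lnDiv, if_neg hβ, ← neg_smul, ← neg_smul, subst_smul_X, ← PowerSeries.subst_smul hs]
    congr 1
    ext k
    rw [map_smul, PowerSeries.coeff_rescale, PowerSeries.coeff_log, lnSeries, PowerSeries.coeff_mk]
    rcases k with _ | k
    · simp
    · have hk : ((k : K) + 1) ≠ 0 := by exact_mod_cast k.succ_ne_zero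
      have h1 : ((-1 : K)) ^ k * (-1) ^ k = 1 := by rw [← mul_pow]; simp
      rw [if_neg k.succ_ne_zero, if_neg k.succ_ne_zero, Nat.add_sub_cancel, neg_pow]
      simp only [map_div₀, map_pow, map_neg, map_one, map_natCast, smul_eq_mul]
      push_cast
      rw [pow_succ _ (k + 1), pow_succ _ k, pow_succ _ k]
      field_simp
      linear_combination h1

end Coordinates

/-! ### Uniqueness of the solution of a system -/

section FixedPoint

variable {K : Type*} [Field K] {I : Type*} {R : Type*} [CommRing R] [Algebra K R]

/-- A morphism, applied to every coefficient of a power series. -/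
abbrev mapCoeff {S : Type*} [CommRing S] [Algebra K S] (φ : R →ₐ[K] S) :
    PowerSeries R →+* PowerSeries S := PowerSeries.map (φ : R →+* S)

/-- A linear map, applied to every coefficient of a power series. -/
def coeffMap (φ : R →ₗ[K] R) : PowerSeries R →ₗ[K] PowerSeries R where
  toFun f := PowerSeries.mk fun n => φ (PowerSeries.coeff n f)
  map_add' f g := by ext n; simp
  map_smul' r f := by ext n; simp

@[simp] theorem coeff_coeffMap (φ : R →ₗ[K] R) (f : PowerSeries R) (n : ℕ) :
    PowerSeries.coeff n (coeffMap φ f) = φ (PowerSeries.coeff n f) := by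
  simp [coeffMap]

theorem constantCoeff_mvSubst [Finite I] {x : I → PowerSeries R} (f : MvPowerSeries I K)
    (hx : ∀ i, PowerSeries.constantCoeff (x i) = 0) :
    PowerSeries.constantCoeff (MvPowerSeries.subst x f : PowerSeries R) =
      algebraMap K R (MvPowerSeries.constantCoeff f) := by
  rw [← PowerSeries.coeff_zero_eq_constantCoeff_apply,
    coeff_mvSubst_congr (Y := 0) (n := 1) hx (fun _ => by simp) (fun i m hm => by
      obtain rfl : m = 0 := by omega
      simp [hx]) f 0 one_pos, MvPowerSeries.subst_zero_eq_C_constantCoeff, PowerSeries.coeff]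
  simp

/-- A system `D i = x i + z φ i (F i (D))` has at most one solution: the right-hand side in degree
`n + 1` depends only on `D` in degrees at most `n`. -/
theorem eq_of_fixedPoint [Finite I] (φ : I → R →ₗ[K] R) (F : I → MvPowerSeries I K)
    {x D E : I → PowerSeries R} (hx : ∀ i, PowerSeries.constantCoeff (x i) = 0)
    (hD : ∀ i, D i = x i + PowerSeries.X * coeffMap (φ i) (MvPowerSeries.subst D (F i)))
    (hE : ∀ i, E i = x i + PowerSeries.X * coeffMap (φ i) (MvPowerSeries.subst E (F i))) :
    D = E := by
  have hD0 : ∀ i, PowerSeries.constantCoeff (D i) = 0 := fun i => by rw [hD i]; simp [hx]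
  have hE0 : ∀ i, PowerSeries.constantCoeff (E i) = 0 := fun i => by rw [hE i]; simp [hx]
  have key : ∀ n, ∀ i, ∀ m < n, PowerSeries.coeff m (D i) = PowerSeries.coeff m (E i) := by
    intro n
    induction n with
    | zero => intro i m hm; omega
    | succ n ih =>
      intro i m hm
      cases m with
      | zero => simp [hD0, hE0]
      | succ m =>
        rw [hD i, hE i, map_add, map_add, PowerSeries.coeff_succ_X_mul,
          PowerSeries.coeff_succ_X_mul, coeff_coeffMap, coeff_coeffMap,
          coeff_mvSubst_congr hD0 hE0 ih (F i) m (by omega)]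
  funext i
  ext n
  exact key (n + 1) i n (by omega)

end FixedPoint

/-! ### The coproduct of the solution and a criterion for Hopf systems -/

section Criterion

variable {K : Type*} [Field K] {I : Type*}

variable (K I) in
/-- `h ↦ h ⊗ 1`. -/
abbrev inl : TreeAlg K I →ₐ[K] TreeAlg K I ⊗[K] TreeAlg K I :=
  Algebra.TensorProduct.includeLeft

variable (K I) in
/-- `h ↦ 1 ⊗ h`. -/
abbrev inr : TreeAlg K I →ₐ[K] TreeAlg K I ⊗[K] TreeAlg K I :=
  Algebra.TensorProduct.includeRight

variable (K) in
/-- `Id ⊗ Bplus i`. -/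
abbrev graftRight (i : I) :
    TreeAlg K I ⊗[K] TreeAlg K I →ₗ[K] TreeAlg K I ⊗[K] TreeAlg K I :=
  LinearMap.lTensor (TreeAlg K I) (Bplus K i)

theorem graftRight_inl_mul (i : I) (h : TreeAlg K I) (z : TreeAlg K I ⊗[K] TreeAlg K I) :
    graftRight K i (inl K I h * z) = inl K I h * graftRight K i z := by
  induction z with
  | zero => simp
  | tmul a b => simp
  | add a b ha hb => simp only [mul_add, map_add, ha, hb]

theorem coeffMap_graftRight_mul (i : I) (u : PowerSeries (TreeAlg K I))
    (f : PowerSeries (TreeAlg K I ⊗[K] TreeAlg K I)) :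
    coeffMap (graftRight K i) (mapCoeff (inl K I) u * f) =
      mapCoeff (inl K I) u * coeffMap (graftRight K i) f := by
  ext n
  rw [coeff_coeffMap, PowerSeries.coeff_mul, PowerSeries.coeff_mul, map_sum]
  refine Finset.sum_congr rfl fun p _ => ?_
  rw [PowerSeries.coeff_map, coeff_coeffMap]
  exact graftRight_inl_mul i _ _

theorem coeffMap_graftRight_subst (i : I) {u : PowerSeries (TreeAlg K I)}
    (hu : PowerSeries.constantCoeff u = 0) (f : PowerSeries (TreeAlg K I)) :
    coeffMap (graftRight K i) (PowerSeries.subst (mapCoeff (inl K I) u)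
        (mapCoeff (inr K I) f)) =
      PowerSeries.subst (mapCoeff (inl K I) u)
        (mapCoeff (inr K I) (coeffMap (Bplus K i) f)) := by
  have hs : PowerSeries.HasSubst (mapCoeff (inl K I) u) :=
    PowerSeries.HasSubst.of_constantCoeff_zero' (by
      rw [← PowerSeries.coeff_zero_eq_constantCoeff_apply, PowerSeries.coeff_map,
        PowerSeries.coeff_zero_eq_constantCoeff_apply, hu, map_zero])
  ext n
  rw [coeff_coeffMap, PowerSeries.coeff_subst' hs, PowerSeries.coeff_subst' hs]
  refine ((graftRight K i).toAddMonoidHom.map_finsum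
    (PowerSeries.coeff_subst_finite' hs _ n)).trans (finsum_congr fun d => ?_)
  rw [← map_pow, PowerSeries.coeff_map, PowerSeries.coeff_map, PowerSeries.coeff_map,
    smul_eq_mul, smul_eq_mul, mul_comm]
  refine (graftRight_inl_mul i _ _).trans ((congrArg (_ * ·) ?_).trans (mul_comm _ _))
  simp

theorem BplusHat_eq (i : I) (f : PowerSeries (TreeAlg K I)) :
    BplusHat i f = PowerSeries.X * coeffMap (Bplus K i) f := by
  ext n
  cases n with
  | zero => simp
  | succ n => rw [coeff_succ_BplusHat, PowerSeries.coeff_succ_X_mul, coeff_coeffMap]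

variable (F : I → MvPowerSeries I K)

theorem constantCoeff_solution (i : I) : PowerSeries.constantCoeff (solution F i) = 0 := by
  rw [← PowerSeries.coeff_zero_eq_constantCoeff_apply, coeff_zero_solution]

theorem constantCoeff_map_solution {R : Type*} [CommRing R] [Algebra K R]
    (φ : TreeAlg K I →ₐ[K] R) (i : I) :
    PowerSeries.constantCoeff (mapCoeff φ (solution F i)) = 0 := by
  rw [← PowerSeries.coeff_zero_eq_constantCoeff_apply, PowerSeries.coeff_map, coeff_zero_solution,
    map_zero]

variable [Finite I]

theorem solution_eq (i : I) :
    solution F i =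
      PowerSeries.X * coeffMap (Bplus K i) (MvPowerSeries.subst (solution F) (F i)) := by
  rw [← BplusHat_eq]
  exact (solution_isSolution F).2 i

theorem coeff_succ_solution (i : I) (n : ℕ) :
    PowerSeries.coeff (n + 1) (solution F i) =
      Bplus K i (PowerSeries.coeff n
        (MvPowerSeries.subst (solution F) (F i) : PowerSeries (TreeAlg K I))) := by
  conv_lhs => rw [solution_eq]
  rw [PowerSeries.coeff_succ_X_mul, coeff_coeffMap]

/-- As the grafting operators are 1-cocycles, the coproducts of the components of the solution
solve a system of the same shape over the tensor square. -/
theorem comul_solution_eq (i : I) :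
    mapCoeff (comul K I) (solution F i) =
      mapCoeff (inl K I) (solution F i) +
        PowerSeries.X * coeffMap (graftRight K i) (MvPowerSeries.subst
          (fun j => mapCoeff (comul K I) (solution F j)) (F i)) := by
  rw [← map_mvSubst (comul K I) (constantCoeff_solution F)]
  ext n
  cases n with
  | zero => simp [constantCoeff_solution, constantCoeff_map_solution F (inl K I)]
  | succ n =>
    rw [map_add, PowerSeries.coeff_succ_X_mul, coeff_coeffMap, PowerSeries.coeff_map,
      PowerSeries.coeff_map, PowerSeries.coeff_map, coeff_succ_solution]
    exact comul_Bplus K i _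

/-- The formal identities which determine the coproduct of the solution of the system: over `R`,
`F i (x j + p j (x) y j + (F j - p j q) (x) w j) = (p i q) (x) F i (y) + (F i - p i q) (x)`. -/
def ShiftIdentity (R : Type*) [CommRing R] [Algebra K R] (p : I → MvPowerSeries I K)
    (q : MvPowerSeries I K) : Prop :=
  ∀ x y w : I → PowerSeries R, (∀ i, PowerSeries.constantCoeff (x i) = 0) →
    (∀ i, PowerSeries.constantCoeff (y i) = 0) → (∀ i, PowerSeries.constantCoeff (w i) = 0) →
    ∀ i, (MvPowerSeries.subst (fun j => x j + (MvPowerSeries.subst x (p j) * y j +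
        (MvPowerSeries.subst x (F j) - MvPowerSeries.subst x (p j) * MvPowerSeries.subst x q) *
          w j)) (F i) : PowerSeries R) =
      MvPowerSeries.subst x (p i) * MvPowerSeries.subst x q * MvPowerSeries.subst y (F i) +
        (MvPowerSeries.subst x (F i) - MvPowerSeries.subst x (p i) * MvPowerSeries.subst x q)

variable {F} {p : I → MvPowerSeries I K} {q : MvPowerSeries I K}

theorem constantCoeff_mapCoeff {R S : Type*} [CommRing R] [Algebra K R] [CommRing S] [Algebra K S]
    (φ : R →ₐ[K] S) {u : PowerSeries R} (hu : PowerSeries.constantCoeff u = 0) :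
    PowerSeries.constantCoeff (mapCoeff φ u) = 0 := by
  rw [← PowerSeries.coeff_zero_eq_constantCoeff_apply, PowerSeries.coeff_map,
    PowerSeries.coeff_zero_eq_constantCoeff_apply, hu, map_zero]

variable (F q) in
/-- The series `z q(X)` in the grading variable `z`, for the solution `X`. -/
def scaling : PowerSeries (TreeAlg K I) :=
  PowerSeries.X * MvPowerSeries.subst (solution F) q

omit [Finite I] in
theorem constantCoeff_scaling : PowerSeries.constantCoeff (scaling F q) = 0 := by
  simp [scaling]

variable (F q) in
/-- `∑ₙ qⁿ ⊗ X i (n)`, where `X i (n)` is the component of degree `n` of the solution. -/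
def scaledSolution (i : I) : PowerSeries (TreeAlg K I ⊗[K] TreeAlg K I) :=
  PowerSeries.subst (mapCoeff (inl K I) (scaling F q)) (mapCoeff (inr K I) (solution F i))

omit [Finite I] in
theorem hasSubst_scaling : PowerSeries.HasSubst (mapCoeff (inl K I) (scaling F q)) :=
  PowerSeries.HasSubst.of_constantCoeff_zero' (constantCoeff_mapCoeff _ constantCoeff_scaling)

/-- The rescaling `z ↦ z q(X)` turns the system for the solution into one for its rescaled copy. -/
theorem scaledSolution_eq (i : I) :
    scaledSolution F q i = mapCoeff (inl K I) (scaling F q) *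
      coeffMap (graftRight K i) (MvPowerSeries.subst (scaledSolution F q) (F i)) := by
  have h : (MvPowerSeries.subst (scaledSolution F q) (F i) :
      PowerSeries (TreeAlg K I ⊗[K] TreeAlg K I)) =
      PowerSeries.subst (mapCoeff (inl K I) (scaling F q))
        (mapCoeff (inr K I) (MvPowerSeries.subst (solution F) (F i))) := by
    rw [map_mvSubst (inr K I) (constantCoeff_solution F), PowerSeries.subst]
    exact (MvPowerSeries.subst_comp_subst_apply
      (hasSubst_of_coeff_zero (constantCoeff_map_solution F (inr K I)))
      (hasSubst_scaling (F := F) (q := q)).const (F i)).symm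
  rw [h, coeffMap_graftRight_subst i constantCoeff_scaling, scaledSolution]
  conv_lhs => rw [solution_eq F i]
  have hs : PowerSeries.HasSubst (mapCoeff (inl K I) (scaling F q)) := hasSubst_scaling
  rw [map_mul, PowerSeries.map_X, PowerSeries.subst_mul hs, PowerSeries.subst_X hs]

theorem constantCoeff_scaledSolution (i : I) :
    PowerSeries.constantCoeff (scaledSolution F q i) = 0 := by
  rw [scaledSolution_eq, map_mul, constantCoeff_mapCoeff _ constantCoeff_scaling, zero_mul]

/-- The coproduct of the solution: `Δ (X i) = X i ⊗ 1 + ∑ₙ p i (X) q(X)ⁿ ⊗ X i (n)`, with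
`p i (X) q(X)` replaced by `F i (X)` in the term `n = 1`. The right-hand side solves the same
system as the left-hand side, by the identities assumed. -/
theorem comul_solution
    (hF : ShiftIdentity F (TreeAlg K I ⊗[K] TreeAlg K I) p q) (i : I) :
    mapCoeff (comul K I) (solution F i) = mapCoeff (inl K I) (solution F i) +
      (mapCoeff (inl K I) (MvPowerSeries.subst (solution F) (p i)) * scaledSolution F q i +
        (mapCoeff (inl K I) (MvPowerSeries.subst (solution F) (F i)) -
          mapCoeff (inl K I) (MvPowerSeries.subst (solution F) (p i)) *
          mapCoeff (inl K I) (MvPowerSeries.subst (solution F) q)) *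
        (PowerSeries.X * PowerSeries.C (inr K I (Bplus K i 1)))) := by
  have hX : ∀ f : MvPowerSeries I K, mapCoeff (inl K I) (MvPowerSeries.subst (solution F) f) =
      MvPowerSeries.subst (fun j => mapCoeff (inl K I) (solution F j)) f :=
    map_mvSubst (inl K I) (constantCoeff_solution F)
  refine congrFun (eq_of_fixedPoint (graftRight K) F
    (x := fun i => mapCoeff (inl K I) (solution F i))
    (D := fun i => mapCoeff (comul K I) (solution F i))
    (E := fun i => mapCoeff (inl K I) (solution F i) +
      (mapCoeff (inl K I) (MvPowerSeries.subst (solution F) (p i)) * scaledSolution F q i +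
        (mapCoeff (inl K I) (MvPowerSeries.subst (solution F) (F i)) -
          mapCoeff (inl K I) (MvPowerSeries.subst (solution F) (p i)) *
          mapCoeff (inl K I) (MvPowerSeries.subst (solution F) q)) *
        (PowerSeries.X * PowerSeries.C (inr K I (Bplus K i 1)))))
    (constantCoeff_map_solution F (inl K I)) (comul_solution_eq F) fun i => ?_) i
  have h := hF (fun j => mapCoeff (inl K I) (solution F j)) (scaledSolution F q)
    (fun j => PowerSeries.X * PowerSeries.C (inr K I (Bplus K j 1)))
    (constantCoeff_map_solution F (inl K I)) constantCoeff_scaledSolution (fun j => by simp) i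
  simp only [← hX] at h
  rw [h, map_add, ← map_mul, ← map_sub, coeffMap_graftRight_mul,
    ← mul_one (mapCoeff (inl K I) (_ - _)), coeffMap_graftRight_mul]
  have hone : coeffMap (graftRight K i) (1 : PowerSeries (TreeAlg K I ⊗[K] TreeAlg K I)) =
      PowerSeries.C (inr K I (Bplus K i 1)) := by
    ext n
    rw [coeff_coeffMap, PowerSeries.coeff_one, PowerSeries.coeff_C]
    split_ifs with hn
    · rw [Algebra.TensorProduct.one_def]
      simp
    · simp
  conv_lhs => rw [scaledSolution_eq i]
  rw [hone, scaling, map_mul, PowerSeries.map_X, map_mul]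
  ring

omit [Finite I] in
theorem coeff_solution_mem (i : I) (n : ℕ) :
    PowerSeries.coeff n (solution F i) ∈ systemAlg F :=
  Algebra.subset_adjoin ⟨i, n, rfl⟩

theorem Bplus_one_mem (h1 : ∀ i, MvPowerSeries.constantCoeff (F i) = 1) (i : I) :
    Bplus K i 1 ∈ systemAlg F := by
  have h := coeff_solution_mem (F := F) i 1
  rwa [coeff_succ_solution, PowerSeries.coeff_zero_eq_constantCoeff_apply,
    constantCoeff_mvSubst _ (constantCoeff_solution F), h1, map_one] at h

omit [Finite I] in
theorem solution_mem_coeffBelow (i : I) (n : ℕ) :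
    solution F i ∈ coeffBelow K (systemAlg F) n :=
  fun _ _ => coeff_solution_mem i _

theorem mapCoeff_mem_coeffBelow {R S : Type*} [CommRing R] [Algebra K R] [CommRing S]
    [Algebra K S] {φ : R →ₐ[K] S} {A : Subalgebra K R} {B : Subalgebra K S}
    (h : ∀ a ∈ A, φ a ∈ B) {n : ℕ} {u : PowerSeries R} (hu : u ∈ coeffBelow K A n) :
    mapCoeff φ u ∈ coeffBelow K B n := fun m hm => by
  rw [PowerSeries.coeff_map]
  exact h _ (hu m hm)

theorem C_mem_coeffBelow {R : Type*} [CommRing R] [Algebra K R] {B : Subalgebra K R} {r : R}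
    (hr : r ∈ B) (n : ℕ) : PowerSeries.C r ∈ coeffBelow K B n := fun m _ => by
  rw [PowerSeries.coeff_C]
  split_ifs
  exacts [hr, B.zero_mem]

theorem X_mem_coeffBelow {R : Type*} [CommRing R] [Algebra K R] (B : Subalgebra K R)
    (n : ℕ) : PowerSeries.X ∈ coeffBelow K B n := fun m _ => by
  rw [PowerSeries.coeff_X]
  split_ifs
  exacts [B.one_mem, B.zero_mem]

theorem scaling_mem_coeffBelow (n : ℕ) : scaling F q ∈ coeffBelow K (systemAlg F) n :=
  mul_mem (X_mem_coeffBelow _ _)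
    (mvSubst_mem_coeffBelow (constantCoeff_solution F) (fun j => solution_mem_coeffBelow j n) q)

/-- The first Hopf condition: the formula for the coproduct of the solution involves only the
components of the solution, on both sides of the tensor product. -/
theorem comul_mem (h1 : ∀ i, MvPowerSeries.constantCoeff (F i) = 1)
    (hF : ShiftIdentity F (TreeAlg K I ⊗[K] TreeAlg K I) p q) :
    ∀ x ∈ systemAlg F, comul K I x ∈
      (Algebra.TensorProduct.map (systemAlg F).val (systemAlg F).val).range := by
  set B := (Algebra.TensorProduct.map (systemAlg F).val (systemAlg F).val).range with hB
  have hl : ∀ a ∈ systemAlg F, inl K I a ∈ B := fun a ha => ⟨(⟨a, ha⟩ : systemAlg F) ⊗ₜ 1, by simp⟩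
  have hr : ∀ a ∈ systemAlg F, inr K I a ∈ B := fun a ha => ⟨1 ⊗ₜ (⟨a, ha⟩ : systemAlg F), by simp⟩
  suffices systemAlg F ≤ B.comap (comul K I) from this
  refine Algebra.adjoin_le ?_
  rintro _ ⟨i, n, rfl⟩
  have hs : ∀ f : MvPowerSeries I K,
      mapCoeff (inl K I) (MvPowerSeries.subst (solution F) f) ∈ coeffBelow K B (n + 1) := fun f =>
    mapCoeff_mem_coeffBelow hl (mvSubst_mem_coeffBelow (constantCoeff_solution F)
      (fun j => solution_mem_coeffBelow j _) f)
  have hy : scaledSolution F q i ∈ coeffBelow K B (n + 1) :=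
    subst_mem_coeffBelow (constantCoeff_mapCoeff _ constantCoeff_scaling)
      (mapCoeff_mem_coeffBelow hl (scaling_mem_coeffBelow _)) fun m => by
        rw [PowerSeries.coeff_map]
        exact hr _ (coeff_solution_mem i m)
  have hmem : mapCoeff (comul K I) (solution F i) ∈ coeffBelow K B (n + 1) := by
    rw [comul_solution hF]
    exact add_mem (mapCoeff_mem_coeffBelow hl (solution_mem_coeffBelow i _))
      (add_mem (mul_mem (hs _) hy) (mul_mem (sub_mem (hs _) (mul_mem (hs _) (hs _)))
        (mul_mem (X_mem_coeffBelow _ _) (C_mem_coeffBelow (hr _ (Bplus_one_mem h1 i)) _))))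
  have h := hmem n n.lt_succ_self
  rwa [PowerSeries.coeff_map] at h

theorem antipodeMul_comul_solution (i : I) :
    mapCoeff (antipodeMul K) (mapCoeff (comul K I) (solution F i)) = 0 := by
  ext1 n
  rw [PowerSeries.coeff_map, PowerSeries.coeff_map]
  cases n with
  | zero => simp [constantCoeff_solution]
  | succ n =>
    rw [coeff_succ_solution]
    exact antipodeMul_comul_Bplus K i _

/-- The second Hopf condition: applying `a ⊗ b ↦ S(a) b` to the formula for the coproduct expresses
the antipode of a component of degree `n + 1` by the components and by their antipodes in degrees
at most `n`. -/
theorem antipode_mem (h1 : ∀ i, MvPowerSeries.constantCoeff (F i) = 1)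
    (hF : ShiftIdentity F (TreeAlg K I ⊗[K] TreeAlg K I) p q) :
    ∀ x ∈ systemAlg F, antipode K I x ∈ systemAlg F := by
  set t : I → PowerSeries (TreeAlg K I) := fun i => mapCoeff (antipode K I) (solution F i) with ht
  have ht0 : ∀ i, PowerSeries.constantCoeff (t i) = 0 := constantCoeff_map_solution F _
  have hl : ∀ u : PowerSeries (TreeAlg K I),
      mapCoeff (antipodeMul K) (mapCoeff (inl K I) u) = mapCoeff (antipode K I) u := by
    intro u
    ext1 n
    simp [PowerSeries.coeff_map]
  have hr : ∀ u : PowerSeries (TreeAlg K I),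
      mapCoeff (antipodeMul K) (mapCoeff (inr K I) u) = u := by
    intro u
    ext1 n
    simp [PowerSeries.coeff_map]
  have hsub : ∀ f : MvPowerSeries I K,
      mapCoeff (antipode K I) (MvPowerSeries.subst (solution F) f) = MvPowerSeries.subst t f :=
    map_mvSubst _ (constantCoeff_solution F)
  -- The factor `z` on the right makes the relation recursive: `scaling F q` is divisible by `z`.
  have hrec : ∀ i, t i = PowerSeries.X * -(MvPowerSeries.subst t (p i) *
      (MvPowerSeries.subst t q * PowerSeries.subst
        (PowerSeries.X * MvPowerSeries.subst t q : PowerSeries (TreeAlg K I))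
        (PowerSeries.mk fun n => PowerSeries.coeff (n + 1) (solution F i))) +
      (MvPowerSeries.subst t (F i) - MvPowerSeries.subst t (p i) * MvPowerSeries.subst t q) *
        PowerSeries.C (Bplus K i 1)) := by
    intro i
    have h := congrArg (mapCoeff (antipodeMul K)) (comul_solution hF i)
    have hs : PowerSeries.HasSubst
        (PowerSeries.X * MvPowerSeries.subst t q : PowerSeries (TreeAlg K I)) :=
      PowerSeries.HasSubst.of_constantCoeff_zero' (by simp)
    have hy : mapCoeff (antipodeMul K) (scaledSolution F q i) = PowerSeries.X *
        (MvPowerSeries.subst t q * PowerSeries.subst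
        (PowerSeries.X * MvPowerSeries.subst t q : PowerSeries (TreeAlg K I))
        (PowerSeries.mk fun n => PowerSeries.coeff (n + 1) (solution F i))) := by
      have hsol : solution F i =
          PowerSeries.X * PowerSeries.mk fun n => PowerSeries.coeff (n + 1) (solution F i) := by
        conv_lhs => rw [PowerSeries.eq_X_mul_shift_add_const (solution F i),
          constantCoeff_solution, map_zero, add_zero]
      have h2 : mapCoeff (antipodeMul K) (scaledSolution F q i) = PowerSeries.subst
          (mapCoeff (antipodeMul K) (mapCoeff (inl K I) (scaling F q)))
          (mapCoeff (antipodeMul K) (mapCoeff (inr K I) (solution F i))) :=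
        PowerSeries.map_subst hasSubst_scaling _
      rw [h2, hl, hr, scaling, map_mul, PowerSeries.map_X, hsub]
      conv_lhs => rw [hsol]
      rw [PowerSeries.subst_mul hs, PowerSeries.subst_X hs, mul_assoc]
    have hC : mapCoeff (antipodeMul K) (PowerSeries.C (inr K I (Bplus K i 1))) =
        PowerSeries.C (Bplus K i 1) := by
      rw [PowerSeries.map_C]
      simp
    rw [antipodeMul_comul_solution] at h
    simp only [map_add, map_mul, map_sub, PowerSeries.map_X, hl, hsub, hy, hC] at h
    linear_combination -h
  have key : ∀ n, ∀ i, t i ∈ coeffBelow K (systemAlg F) n := by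
    intro n
    induction n with
    | zero => intro i m hm; omega
    | succ n ih =>
      intro i
      have hs : ∀ f : MvPowerSeries I K,
          (MvPowerSeries.subst t f : PowerSeries (TreeAlg K I)) ∈ coeffBelow K (systemAlg F) n :=
        fun f => mvSubst_mem_coeffBelow ht0 ih f
      rw [hrec i]
      refine X_mul_mem_coeffBelow (neg_mem (add_mem (mul_mem (hs _) (mul_mem (hs _)
        (subst_mem_coeffBelow (by simp) (mul_mem (X_mem_coeffBelow _ _) (hs _)) fun m => ?_)))
        (mul_mem (sub_mem (hs _) (mul_mem (hs _) (hs _)))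
          (C_mem_coeffBelow (Bplus_one_mem h1 i) _))))
      rw [PowerSeries.coeff_mk]
      exact coeff_solution_mem i _
  suffices systemAlg F ≤ (systemAlg F).comap (antipode K I) from this
  refine Algebra.adjoin_le ?_
  rintro _ ⟨i, n, rfl⟩
  have h := key (n + 1) i n n.lt_succ_self
  rwa [ht, PowerSeries.coeff_map] at h

/-- A system whose series satisfy the shift identities is Hopf. -/
theorem isHopfSystem_of_shiftIdentity (h1 : ∀ i, MvPowerSeries.constantCoeff (F i) = 1)
    (hF : ShiftIdentity F (TreeAlg K I ⊗[K] TreeAlg K I) p q) : IsHopfSystem F :=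
  ⟨comul_mem h1 hF, antipode_mem h1 hF⟩

end Criterion

/-! ### Systems given by products of powers of `1 - β h` -/

section Fundamental

variable {K : Type*} [Field K] [CharZero K] {I : Type*} [Finite I] {R : Type*} [CommRing R]
  [Algebra K R] (T : Finset I) (B : I → K)

omit [CharZero K] in
theorem constantCoeff_binomAt (β c : K) (j : I) :
    MvPowerSeries.constantCoeff (binomAt β c j : MvPowerSeries I K) = 1 := by
  have h := constantCoeff_mvSubst (R := K) (x := 0) (binomAt β c j) fun _ => by simp
  rw [subst_binomAt fun _ => by simp, constantCoeff_binom _ _ (by simp)] at h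
  exact h.symm

theorem constantCoeff_lnDiv (β : K) (j : I) :
    MvPowerSeries.constantCoeff (lnDiv β j : MvPowerSeries I K) = 0 := by
  have h := constantCoeff_mvSubst (R := K) (x := 0) (lnDiv β j) fun _ => by simp
  rw [subst_lnDiv fun _ => by simp, constantCoeff_lnOf _ (by simp)] at h
  exact h.symm

/-- `∏_{j ∈ T} (1 - B_j h_j) ^ (- c_j / B_j)`. -/
def binomProd (c : I → K) : MvPowerSeries I K := ∏ j ∈ T, binomAt (B j) (c j) j

omit [CharZero K] [Finite I] in
theorem binomProd_congr {c c' : I → K} (h : ∀ j ∈ T, c j = c' j) :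
    binomProd T B c = binomProd T B c' :=
  Finset.prod_congr rfl fun j hj => by rw [h j hj]

omit [CharZero K] in
theorem constantCoeff_binomProd (c : I → K) :
    MvPowerSeries.constantCoeff (binomProd T B c) = 1 := by
  rw [binomProd, map_prod]
  exact Finset.prod_eq_one fun j _ => constantCoeff_binomAt _ _ _

omit [CharZero K] in
theorem subst_binomProd {x : I → PowerSeries R} (hx : ∀ i, PowerSeries.constantCoeff (x i) = 0)
    (c : I → K) : (MvPowerSeries.subst x (binomProd T B c) : PowerSeries R) =
      ∏ j ∈ T, binom (B j) (c j) (x j) := by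
  rw [binomProd, ← MvPowerSeries.coe_substAlgHom (hasSubst_of_coeff_zero hx), map_prod,
    MvPowerSeries.coe_substAlgHom]
  exact Finset.prod_congr rfl fun j _ => subst_binomAt hx _ _ _

theorem subst_binomProd_add {x : I → PowerSeries R}
    (hx : ∀ i, PowerSeries.constantCoeff (x i) = 0) (c c' : I → K) :
    (MvPowerSeries.subst x (binomProd T B (c + c')) : PowerSeries R) =
      MvPowerSeries.subst x (binomProd T B c) * MvPowerSeries.subst x (binomProd T B c') := by
  rw [subst_binomProd T B hx, subst_binomProd T B hx, subst_binomProd T B hx,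
    ← Finset.prod_mul_distrib]
  exact Finset.prod_congr rfl fun j _ => binom_add _ _ _ (hx j)

theorem subst_binomProd_eq_one {x : I → PowerSeries R}
    (hx : ∀ i, PowerSeries.constantCoeff (x i) = 0) {c : I → K} (hc : ∀ j ∈ T, c j = 0) :
    (MvPowerSeries.subst x (binomProd T B c) : PowerSeries R) = 1 := by
  rw [subst_binomProd T B hx]
  exact Finset.prod_eq_one fun j hj => by rw [hc j hj, binom_zero _ (hx j)]

theorem subst_binomProd_single [DecidableEq I] {x : I → PowerSeries R}
    (hx : ∀ i, PowerSeries.constantCoeff (x i) = 0) {i : I} (hi : i ∈ T) :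
    (MvPowerSeries.subst x (binomProd T B (Pi.single i (-B i))) : PowerSeries R) =
      1 - B i • x i := by
  rw [subst_binomProd T B hx, Finset.prod_eq_single_of_mem i hi fun j _ hj => ?_]
  · rw [Pi.single_eq_same, binom_neg_self _ (hx i)]
  · rw [Pi.single_eq_of_ne hj, binom_zero _ (hx j)]

variable {T B}

/-- A system is Hopf if its series are affine functions of products of powers of the `1 - B_j h_j`,
with an additional linear term, or sums of logarithms. Here `p i = ∏ (1 - B_j h_j) ^ (- c i j / B_j)`
and `q = ∏ (1 - B_j h_j) ^ (- e j / B_j)`; for `i` in `T` the first is `1 - B_i h_i`. The condition on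
the linear part `∑ a_j h_j` says that `p j = p i q` for all its indices `j`. -/
theorem isHopfSystem_of_binomProd [DecidableEq I] {F : I → MvPowerSeries I K} (e : I → K)
    (c : I → I → K) (hT : ∀ i ∈ T, c i = Pi.single i (-B i) ∧ F i = binomProd T B (c i + e))
    (hF : ∀ i, (∃ (κ : K) (S : Finset I) (a : I → K), F i = κ • binomProd T B (c i + e) +
        ∑ j ∈ S, a j • (MvPowerSeries.X j : MvPowerSeries I K) + MvPowerSeries.C (1 - κ) ∧
        ∀ j ∈ S, F j = binomProd T B (c j + e) ∧ ∀ t ∈ T, c j t = c i t + e t) ∨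
      ∃ a : I → K, F i = ∑ j ∈ T, a j • lnDiv (B j) j + 1 ∧ ∀ t ∈ T, c i t + e t = 0) :
    IsHopfSystem F := by
  refine isHopfSystem_of_shiftIdentity (p := fun i => binomProd T B (c i))
    (q := binomProd T B e) (fun i => ?_) ?_
  · obtain ⟨κ, S, a, h, -⟩ | ⟨a, h, -⟩ := hF i
    · rw [h]
      simp [MvPowerSeries.constantCoeff_smul, constantCoeff_binomProd]
    · rw [h]
      simp [MvPowerSeries.constantCoeff_smul, constantCoeff_lnDiv]
  intro x y w hx hy hw i
  -- For `j` in `T`, `1 - B_j Z_j = (1 - B_j x_j) (1 - B_j y_j)`: products of powers are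
  -- multiplicative and logarithms additive under the passage from `x` and `y` to `Z`.
  set Z := fun j => x j + (MvPowerSeries.subst x (binomProd T B (c j)) * y j +
        (MvPowerSeries.subst x (F j) - MvPowerSeries.subst x (binomProd T B (c j)) *
          MvPowerSeries.subst x (binomProd T B e)) * w j) with hZ
  have hZ0 : ∀ j, PowerSeries.constantCoeff (Z j) = 0 := fun j => by simp [hZ, hx, hy, hw]
  have hZ1 : ∀ j, F j = binomProd T B (c j + e) →
      Z j = x j + MvPowerSeries.subst x (binomProd T B (c j)) * y j := by
    intro j hj
    simp only [hZ, hj, subst_binomProd_add T B hx, sub_self, zero_mul, add_zero]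
  have hZT : ∀ j ∈ T, Z j = x j + (1 - B j • x j) * y j := by
    intro j hj
    rw [hZ1 j (hT j hj).2, (hT j hj).1, subst_binomProd_single T B hx hj]
  have hmul : ∀ d : I → K,
      (MvPowerSeries.subst Z (binomProd T B d) : PowerSeries (TreeAlg K I ⊗[K] TreeAlg K I)) =
      MvPowerSeries.subst x (binomProd T B d) * MvPowerSeries.subst y (binomProd T B d) := by
    intro d
    rw [subst_binomProd T B hx, subst_binomProd T B hy, subst_binomProd T B hZ0,
      ← Finset.prod_mul_distrib]
    exact Finset.prod_congr rfl fun j hj => by rw [hZT j hj, binom_mul _ _ (hx j) (hy j)]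
  obtain ⟨κ, S, a, h, hS⟩ | ⟨a, h, hc⟩ := hF i
  · have hsub : ∀ v : I → PowerSeries (TreeAlg K I ⊗[K] TreeAlg K I),
        (∀ j, PowerSeries.constantCoeff (v j) = 0) → MvPowerSeries.subst v (F i) =
        κ • MvPowerSeries.subst v (binomProd T B (c i + e)) + ∑ j ∈ S, a j • v j +
          algebraMap K _ (1 - κ) := by
      intro v hv
      rw [h, ← MvPowerSeries.coe_substAlgHom (hasSubst_of_coeff_zero hv)]
      simp only [map_add, map_smul, map_sum, MvPowerSeries.substAlgHom_X]
      congr 1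
      exact AlgHom.commutes _ _
    have hsum : ∑ j ∈ S, a j • Z j = ∑ j ∈ S, a j • x j +
        MvPowerSeries.subst x (binomProd T B (c i + e)) * ∑ j ∈ S, a j • y j := by
      rw [Finset.mul_sum, ← Finset.sum_add_distrib]
      refine Finset.sum_congr rfl fun j hj => ?_
      rw [hZ1 j (hS j hj).1, binomProd_congr T B (hS j hj).2, smul_add, mul_smul_comm]
      rfl
    rw [hsub Z hZ0, hsub x hx, hsub y hy, hmul, hsum, ← subst_binomProd_add T B hx]
    simp only [Algebra.smul_def, map_sub, map_one]
    ring
  · have hsub : ∀ v : I → PowerSeries (TreeAlg K I ⊗[K] TreeAlg K I),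
        (∀ j, PowerSeries.constantCoeff (v j) = 0) → MvPowerSeries.subst v (F i) =
        ∑ j ∈ T, a j • lnOf (B j) (v j) + 1 := by
      intro v hv
      rw [h, ← MvPowerSeries.coe_substAlgHom (hasSubst_of_coeff_zero hv)]
      simp only [map_add, map_smul, map_sum, map_one, MvPowerSeries.coe_substAlgHom,
        subst_lnDiv hv]
    have hsum : ∑ j ∈ T, a j • lnOf (B j) (Z j) =
        ∑ j ∈ T, a j • lnOf (B j) (x j) + ∑ j ∈ T, a j • lnOf (B j) (y j) := by
      rw [← Finset.sum_add_distrib]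
      exact Finset.sum_congr rfl fun j hj => by
        rw [hZT j hj, lnOf_add _ (hx j) (hy j), smul_add]
    rw [hsub Z hZ0, hsub x hx, hsub y hy, hsum, ← subst_binomProd_add T B hx,
      subst_binomProd_eq_one T B hx (c := c i + e) hc]
    ring

omit [CharZero K] [Finite I] in
theorem binomAt_zero (β : K) (j : I) : (binomAt β 0 j : MvPowerSeries I K) = 1 := by
  rw [← fDiv_eq_binomAt, fDiv, fAt, zero_smul, PowerSeries.subst_zero_eq_C_constantCoeff]
  simp [fSeries, ← PowerSeries.coeff_zero_eq_constantCoeff_apply]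

end Fundamental

end DysonSchwinger

end

theorem theorem32 {K : Type*} [Field K] [CharZero K] {I : Type*} [Fintype I] [DecidableEq I]
    (I₀ J₀ K₀ I₁ J₁ : Finset I)
    (hdisj : [I₀, J₀, K₀, I₁, J₁].Pairwise Disjoint)
    (hcover : I₀ ∪ J₀ ∪ K₀ ∪ I₁ ∪ J₁ = Finset.univ)
    (hne : (I₀ ∪ J₀).Nonempty)
    (β ν : I → K) (a b : I → I → K) (F : I → MvPowerSeries I K)
    (hI₀ : ∀ i ∈ I₀, F i = fAt (β i) 1 i *
      (∏ j ∈ I₀.erase i, fDiv (β j) (1 + β j) j) * ∏ j ∈ J₀, fAt 1 1 j)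
    (hJ₀ : ∀ i ∈ J₀, F i =
      (∏ j ∈ I₀, fDiv (β j) (1 + β j) j) * ∏ j ∈ J₀.erase i, fAt 1 1 j)
    (hK₀ : ∀ i ∈ K₀, F i =
      (∏ j ∈ I₀, fDiv (β j) (1 + β j) j) * ∏ j ∈ J₀, fAt 1 1 j)
    (hI₁_cond : ∀ i ∈ I₁, ν i ≠ 1 ∨ (∃ j ∈ I₀, a i j ≠ 1 + β j) ∨ (∃ j ∈ J₀, a i j ≠ 1) ∨
      ∃ j ∈ K₀, a i j ≠ 0)
    (hI₁ : ∀ i ∈ I₁, ν i ≠ 0 → F i =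
      (ν i)⁻¹ • ((∏ j ∈ I₀, fDiv (β j) (ν i * a i j) j) *
        (∏ j ∈ J₀, fDiv 1 (ν i * a i j) j) * ∏ j ∈ K₀, fAt 0 (ν i * a i j) j) +
      MvPowerSeries.C (1 - (ν i)⁻¹))
    (hI₁_zero : ∀ i ∈ I₁, ν i = 0 → F i =
      ∑ j ∈ I₀, a i j • lnDiv (β j) j + ∑ j ∈ J₀, a i j • lnDiv 1 j +
        ∑ j ∈ K₀, a i j • (MvPowerSeries.X j : MvPowerSeries I K) + 1)
    (hJ₁_ν : ∀ i ∈ J₁, ν i ≠ 0)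
    (hJ₁_nonempty : ∀ i ∈ J₁, ∃ j ∈ I₁, a i j ≠ 0)
    (hJ₁_one : ∀ i ∈ J₁, ∀ j ∈ I₁, a i j ≠ 0 → ν j = 1)
    (hJ₁_eq : ∀ i ∈ J₁, ∀ j ∈ I₁, ∀ k ∈ I₁, a i j ≠ 0 → a i k ≠ 0 → F j = F k)
    (hb : ∀ i ∈ J₁, ∀ j ∈ I₁, a i j ≠ 0 → ∀ t ∈ I₀ ∪ J₀ ∪ K₀, b i t = a j t)
    (hJ₁ : ∀ i ∈ J₁, F i =
      (ν i)⁻¹ • ((∏ j ∈ I₀, fDiv (β j) (b i j - 1 - β j) j) *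
        (∏ j ∈ J₀, fDiv 1 (b i j - 1) j) * ∏ j ∈ K₀, fAt 0 (b i j) j) +
      ∑ j ∈ I₁, a i j • (MvPowerSeries.X j : MvPowerSeries I K) +
      MvPowerSeries.C (1 - (ν i)⁻¹)) :
    IsHopfSystem F := by
  obtain ⟨hIJ, hIK, hI1, hI2, hJK, hJ1, hJ2, hK1, hK2, h12⟩ :
      Disjoint I₀ J₀ ∧ Disjoint I₀ K₀ ∧ Disjoint I₀ I₁ ∧ Disjoint I₀ J₁ ∧ Disjoint J₀ K₀ ∧
        Disjoint J₀ I₁ ∧ Disjoint J₀ J₁ ∧ Disjoint K₀ I₁ ∧ Disjoint K₀ J₁ ∧ Disjoint I₁ J₁ := by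
    simpa [and_assoc] using hdisj
  rw [Finset.disjoint_left] at hIJ hIK hI1 hI2 hJK hJ1 hJ2 hK1 hK2 h12
  have hcov : ∀ i, i ∈ I₀ ∨ i ∈ J₀ ∨ i ∈ K₀ ∨ i ∈ I₁ ∨ i ∈ J₁ := fun i => by
    have := Finset.mem_univ i
    rw [← hcover] at this
    simpa using this
  set T := I₀ ∪ J₀ ∪ K₀ with hT
  have hTm : ∀ i, i ∈ T ↔ i ∈ I₀ ∨ i ∈ J₀ ∨ i ∈ K₀ := fun i => by simp [hT]
  -- `B` and `e` describe `q = ∏_{I₀} (1 - β_j h_j) ^ (- (1 + β_j) / β_j)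
  -- ∏_{J₀} (1 - h_j)⁻¹`, in which the indices of `K₀` are given the trivial factor.
  let B : I → K := fun j => if j ∈ I₀ then β j else if j ∈ J₀ then 1 else 0
  let e : I → K := fun j => if j ∈ I₀ then 1 + β j else if j ∈ J₀ then 1 else 0
  -- The exponents of the series `p i`; they are those of `F i / q` on `I₀`, `J₀`, `K₀`, of
  -- `(F i - 1 + 1 / ν i) / q` on `I₁` up to the factor `ν i`, and of `p j / q` on `J₁`, where
  -- `a i j ≠ 0`. If `ν i = 0`, then `p i = 1 / q`.
  let c : I → I → K := fun i =>
    if i ∈ T then Pi.single i (-B i) else if i ∈ I₁ then ν i • a i - e else b i - e - e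
  have hBI : ∀ j ∈ I₀, B j = β j := fun j hj => if_pos hj
  have hBJ : ∀ j ∈ J₀, B j = 1 := fun j hj =>
    (if_neg fun h => hIJ h hj).trans (if_pos hj)
  have hBK : ∀ j ∈ K₀, B j = 0 := fun j hj =>
    (if_neg fun h => hIK h hj).trans (if_neg fun h => hJK h hj)
  have heI : ∀ j ∈ I₀, e j = 1 + β j := fun j hj => if_pos hj
  have heJ : ∀ j ∈ J₀, e j = 1 := fun j hj =>
    (if_neg fun h => hIJ h hj).trans (if_pos hj)
  have heK : ∀ j ∈ K₀, e j = 0 := fun j hj =>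
    (if_neg fun h => hIK h hj).trans (if_neg fun h => hJK h hj)
  have hcT : ∀ i ∈ T, c i = Pi.single i (-B i) := fun i hi => if_pos hi
  have hcI : ∀ i ∈ I₁, c i = ν i • a i - e := fun i hi =>
    (if_neg fun h => by
      rcases (hTm i).1 h with h | h | h
      exacts [hI1 h hi, hJ1 h hi, hK1 h hi]).trans (if_pos hi)
  have hcJ : ∀ i ∈ J₁, c i = b i - e - e := fun i hi =>
    (if_neg fun h => by
      rcases (hTm i).1 h with h | h | h
      exacts [hI2 h hi, hJ2 h hi, hK2 h hi]).trans (if_neg fun h => h12 h hi)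
  have hIJ' : Disjoint I₀ J₀ := Finset.disjoint_left.2 fun i h => hIJ h
  have hIJK : Disjoint (I₀ ∪ J₀) K₀ := Finset.disjoint_left.2 fun i h => by
    rcases Finset.mem_union.1 h with h | h
    exacts [hIK h, hJK h]
  have hprod : ∀ d : I → K, binomProd T B d = (∏ j ∈ I₀, fDiv (β j) (d j) j) *
      (∏ j ∈ J₀, fDiv 1 (d j) j) * ∏ j ∈ K₀, fAt 0 (d j) j := by
    intro d
    rw [binomProd, hT, Finset.prod_union hIJK, Finset.prod_union hIJ']
    congr 1
    · congr 1
      · exact Finset.prod_congr rfl fun j hj => by rw [hBI j hj, fDiv_eq_binomAt]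
      · exact Finset.prod_congr rfl fun j hj => by rw [hBJ j hj, fDiv_eq_binomAt]
    · exact Finset.prod_congr rfl fun j hj => by rw [hBK j hj, fAt_eq_binomAt, zero_mul]
  have hzero : ∀ (γ : K) (j : I), (fDiv γ 0 j : MvPowerSeries I K) = 1 := fun γ j => by
    rw [fDiv_eq_binomAt, binomAt_zero]
  have hone : ∀ (γ : K) (j : I), (fAt γ 1 j : MvPowerSeries I K) = fDiv γ 1 j := fun γ j => by
    rw [fAt_eq_binomAt, mul_one, fDiv_eq_binomAt]
  have hFT : ∀ i ∈ T, F i = binomProd T B (c i + e) := by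
    intro i hi
    have hne' : ∀ j, j ≠ i → (c i + e) j = e j := fun j hj => by
      rw [hcT i hi, Pi.add_apply, Pi.single_eq_of_ne hj, zero_add]
    have hself : (c i + e) i = e i - B i := by
      rw [hcT i hi, Pi.add_apply, Pi.single_eq_same]; ring
    have hPI : ∀ s ⊆ I₀, i ∉ s → ∏ j ∈ s, fDiv (β j) ((c i + e) j) j =
        ∏ j ∈ s, (fDiv (β j) (1 + β j) j : MvPowerSeries I K) := fun s hs his =>
      Finset.prod_congr rfl fun j hj => by
        rw [hne' j fun h => his (h ▸ hj), heI j (hs hj)]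
    have hPJ : ∀ s ⊆ J₀, i ∉ s → ∏ j ∈ s, fDiv 1 ((c i + e) j) j =
        ∏ j ∈ s, (fAt 1 1 j : MvPowerSeries I K) := fun s hs his =>
      Finset.prod_congr rfl fun j hj => by
        rw [hne' j fun h => his (h ▸ hj), heJ j (hs hj), hone]
    have hPK : ∏ j ∈ K₀, (fAt 0 ((c i + e) j) j : MvPowerSeries I K) = 1 :=
      Finset.prod_eq_one fun j hj => by
        have h0 : (c i + e) j = 0 := by
          by_cases hji : j = i
          · rw [hji, hself, heK i (hji ▸ hj), hBK i (hji ▸ hj), sub_zero]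
          · rw [hne' j hji, heK j hj]
        rw [h0, fAt_eq_binomAt, binomAt_zero]
    rw [hprod, hPK, mul_one]
    rcases (hTm i).1 hi with h | h | h
    · rw [hI₀ i h, ← Finset.mul_prod_erase I₀ _ h, hself, heI i h, hBI i h,
        hPI _ (Finset.erase_subset _ _) (Finset.notMem_erase _ _),
        hPJ _ subset_rfl fun h' => hIJ h h', hone]
      congr 3
      ring
    · rw [hJ₀ i h, ← Finset.mul_prod_erase J₀ _ h, hself, heJ i h, hBJ i h, sub_self, hzero,
        one_mul, hPI _ subset_rfl fun h' => hIJ h' h,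
        hPJ _ (Finset.erase_subset _ _) (Finset.notMem_erase _ _)]
    · rw [hK₀ i h, hPI _ subset_rfl fun h' => hIK h' h, hPJ _ subset_rfl fun h' => hJK h' h]
  have hcI' : ∀ i ∈ I₁, c i + e = ν i • a i := fun i hi => by rw [hcI i hi, sub_add_cancel]
  have hcJ' : ∀ i ∈ J₁, c i + e = b i - e := fun i hi => by rw [hcJ i hi, sub_add_cancel]
  refine isHopfSystem_of_binomProd e c (fun i hi => ⟨hcT i hi, hFT i hi⟩) fun i => ?_
  by_cases hiT : i ∈ T
  · refine Or.inl ⟨1, ∅, 0, ?_, by simp⟩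
    rw [← hFT i hiT]
    simp
  obtain hi | hi : i ∈ I₁ ∨ i ∈ J₁ := by
    rcases hcov i with h | h | h | h | h
    exacts [(hiT ((hTm i).2 (Or.inl h))).elim, (hiT ((hTm i).2 (Or.inr (Or.inl h)))).elim,
      (hiT ((hTm i).2 (Or.inr (Or.inr h)))).elim, Or.inl h, Or.inr h]
  · by_cases hν : ν i = 0
    · refine Or.inr ⟨a i, ?_, fun t _ => ?_⟩
      · rw [hI₁_zero i hi hν, hT, Finset.sum_union hIJK, Finset.sum_union hIJ']
        congr 1
        congr 1
        · congr 1
          · exact Finset.sum_congr rfl fun j hj => by rw [hBI j hj]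
          · exact Finset.sum_congr rfl fun j hj => by rw [hBJ j hj]
        · exact Finset.sum_congr rfl fun j hj => by rw [hBK j hj, lnDiv, if_pos rfl]
      · rw [← Pi.add_apply, hcI' i hi, hν, zero_smul, Pi.zero_apply]
    · refine Or.inl ⟨(ν i)⁻¹, ∅, 0, ?_, by simp⟩
      rw [hI₁ i hi hν, hcI' i hi, hprod]
      simp
  · classical
    refine Or.inl ⟨(ν i)⁻¹, I₁.filter fun j => a i j ≠ 0, a i, ?_, fun j hj => ?_⟩
    · have h1 : binomProd T B (c i + e) = (∏ j ∈ I₀, fDiv (β j) (b i j - 1 - β j) j) *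
          (∏ j ∈ J₀, fDiv 1 (b i j - 1) j) * ∏ j ∈ K₀, fAt 0 (b i j) j := by
        rw [hprod, hcJ' i hi]
        congr 1
        · congr 1
          · exact Finset.prod_congr rfl fun j hj => by rw [Pi.sub_apply, heI j hj, sub_sub]
          · exact Finset.prod_congr rfl fun j hj => by rw [Pi.sub_apply, heJ j hj]
        · exact Finset.prod_congr rfl fun j hj => by rw [Pi.sub_apply, heK j hj, sub_zero]
      have h2 : ∑ j ∈ I₁ with a i j ≠ 0, a i j • (MvPowerSeries.X j : MvPowerSeries I K) =
          ∑ j ∈ I₁, a i j • MvPowerSeries.X j :=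
        Finset.sum_filter_of_ne fun j _ h h0 => h (by rw [h0, zero_smul])
      rw [hJ₁ i hi, h1, h2]
    · obtain ⟨hj, haj⟩ := Finset.mem_filter.1 hj
      have hν := hJ₁_one i hi j hj haj
      refine ⟨?_, fun t ht => ?_⟩
      · rw [hI₁ j hj (by rw [hν]; exact one_ne_zero), hcI' j hj, hprod]
        simp [hν]
      · rw [← Pi.add_apply (c i), hcJ' i hi, hcI j hj, hν, one_smul, Pi.sub_apply, Pi.sub_apply,
          hb i hi j hj haj t ht]
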